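/- Let $k$ be a field, let $m,n>1$ be integers, and let $y$ be the Vigenère ciphertext, over the alphabet $\mathscr A=\mathbb Z/n$, of some plaintext $x=(x_0,\dots,x_{N-1})$ under a key $K=(k_1,\dots,k_m)$, that is, $y_t=x_t+k_{(t \bmod m)+1}$. For $1\le i\le m$ let $y_i$ be the list of the letters of $y$ at the positions $t\equiv i-1 \pmod m$, and let $f_{i,j}$ be the number of occurrences of the letter $j\in\mathscr A$ in $y_i$. Assume that every $y_i$ has length greater than $1$ and that every letter of $\mathscr A$ occurs more than once in $y$. Let $\mathfrak C$ be the Brauer configuration whose vertices are the letters $j\in\mathscr A$, whose polygons are the multisets $y_1,\dots,y_m$, whose multiplicity function is $\mu\equiv 1$, and in which the successor sequence of $j$ lists $y_1$ $f_{1,j}$ times, then $y_2$ $f_{2,j}$ times, and so on up to $y_m$, and is closed up to a circular order. Let $\Lambda_{\mathfrak C}=kQ/I$ be its Brauer configuration algebra: $Q$ has the polygons as vertices and, for each letter and each two consecutive places of its circular order, an arrow from the polygon at the first place to the polygon at the second; the special cycle at a place of the circular order of $j$ is the closed path in $Q$ that starts there and runs once around the circular order; and $I$ is generated by all differences $C-C'$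 of special cycles starting at the same polygon, all products $Ca$ of a special cycle $C$ with its first arrow $a$, and all paths $ab$ of two arrows that are not consecutive in a circular order. Let $Z(\Lambda_{\mathfrak C})$ be the center of $\Lambda_{\mathfrak C}$. (a) If every letter of $\mathscr A$ occurs in every list $y_i$, then $$\dim_k Z(\Lambda_{\mathfrak C})=1+m+\sum_{i=1}^m\sum_{j\in\mathscr A}(f_{i,j}-1).$$ (b) More generally, if $\mathfrak C$ is connected (any two polygons are linked by a chain of polygons in which consecutive ones have a common letter) and every letter of $\mathscr A$ occurs in at least two of the lists $y_1,\dots,y_m$, then $$\dim_k Z(\Lambda_{\mathfrak C})=1+m+\sum_{i=1}^m\ \sum_{j\in\mathscr A,\ f_{i,j}\ge 1}(f_{i,j}-1).$$ -/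

import Mathlib

noncomputable section

universe u v w

/-! ### The path algebra of a quiver with finitely many vertices -/

/-- The path algebra `kQ` of a quiver with finitely many vertices. An element is a finite formal
`k`-linear combination of paths, stored as a family of linear combinations of paths from `i` to `j`,
one for each pair of vertices `i, j`. -/
@[ext]
structure PathAlgebra (k : Type u) [Field k] (Q : Type v) [Quiver.{w} Q] where
  /-- The component spanned by the paths from `i` to `j`. -/
  comp : ∀ i j : Q, Quiver.Path i j →₀ k

namespace PathAlgebra

variable {k : Type u} [Field k] {Q : Type v} [Quiver.{w} Q]

instance : Zero (PathAlgebra k Q) := ⟨⟨fun _ _ => 0⟩⟩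
instance : Add (PathAlgebra k Q) := ⟨fun a b => ⟨fun i j => a.comp i j + b.comp i j⟩⟩
instance : Neg (PathAlgebra k Q) := ⟨fun a => ⟨fun i j => -a.comp i j⟩⟩
instance : Sub (PathAlgebra k Q) := ⟨fun a b => ⟨fun i j => a.comp i j - b.comp i j⟩⟩
instance : SMul k (PathAlgebra k Q) := ⟨fun c a => ⟨fun i j => c • a.comp i j⟩⟩
instance : SMul ℕ (PathAlgebra k Q) := ⟨fun c a => ⟨fun i j => c • a.comp i j⟩⟩
instance : SMul ℤ (PathAlgebra k Q) := ⟨fun c a => ⟨fun i j => c • a.comp i j⟩⟩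

theorem comp_injective : Function.Injective (PathAlgebra.comp : PathAlgebra k Q → _) :=
  fun _ _ h => PathAlgebra.ext h

instance : AddCommGroup (PathAlgebra k Q) :=
  comp_injective.addCommGroup _ rfl (fun _ _ => rfl) (fun _ => rfl) (fun _ _ => rfl)
    (fun _ _ => rfl) (fun _ _ => rfl)

/-- `comp` as an additive homomorphism. -/
def compHom : PathAlgebra k Q →+ ∀ i j : Q, Quiver.Path i j →₀ k where
  toFun := comp
  map_zero' := rfl
  map_add' _ _ := rfl

instance : Module k (PathAlgebra k Q) :=
  comp_injective.module k compHom (fun _ _ => rfl)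

/-- Concatenation of paths, extended bilinearly. -/
def concat {i j l : Q} :
    (Quiver.Path i j →₀ k) →ₗ[k] (Quiver.Path j l →₀ k) →ₗ[k] (Quiver.Path i l →₀ k) :=
  Finsupp.linearCombination k fun p => Finsupp.lmapDomain k k fun q => p.comp q

theorem concat_single {i j l : Q} (p : Quiver.Path i j) (q : Quiver.Path j l) (c d : k) :
    concat (Finsupp.single p c) (Finsupp.single q d) = Finsupp.single (p.comp q) (c * d) := by
  simp [concat, Finsupp.mapDomain_single]

theorem concat_assoc {i j l r : Q} (f : Quiver.Path i j →₀ k) (g : Quiver.Path j l →₀ k)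
    (h : Quiver.Path l r →₀ k) : concat (concat f g) h = concat f (concat g h) := by
  induction f using Finsupp.induction_linear with
  | zero => simp
  | add f₁ f₂ h₁ h₂ => simp only [map_add, LinearMap.add_apply, h₁, h₂]
  | single p c =>
    induction g using Finsupp.induction_linear with
    | zero => simp
    | add f₁ f₂ h₁ h₂ => simp only [map_add, LinearMap.add_apply, h₁, h₂]
    | single q d =>
      induction h using Finsupp.induction_linear with
      | zero => simp
      | add f₁ f₂ h₁ h₂ => simp only [map_add, h₁, h₂]
      | single s e => simp only [concat_single, Quiver.Path.comp_assoc, mul_assoc]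

theorem nil_concat {i j : Q} (f : Quiver.Path i j →₀ k) :
    concat (Finsupp.single Quiver.Path.nil 1) f = f := by
  induction f using Finsupp.induction_linear with
  | zero => simp
  | add f₁ f₂ h₁ h₂ => simp only [map_add, h₁, h₂]
  | single p c => simp only [concat_single, Quiver.Path.nil_comp, one_mul]

theorem concat_nil {i j : Q} (f : Quiver.Path i j →₀ k) :
    concat f (Finsupp.single Quiver.Path.nil 1) = f := by
  induction f using Finsupp.induction_linear with
  | zero => simp
  | add f₁ f₂ h₁ h₂ => simp only [map_add, LinearMap.add_apply, h₁, h₂]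
  | single p c => simp only [concat_single, Quiver.Path.comp_nil, mul_one]

variable [DecidableEq Q]

/-- The basis element of the path algebra given by a path `p` from `i` to `j`: its component at
`(i, j)` is `p` and all other components are zero. -/
def ofPath {i j : Q} (p : Quiver.Path i j) : PathAlgebra k Q :=
  ⟨fun i' j' => if h : i = i' ∧ j = j' then Finsupp.single (p.cast h.1 h.2) 1 else 0⟩

variable [Fintype Q]

/-- The product is the bilinear extension of the concatenation of paths; products of non-composable
paths are zero. -/
instance : Mul (PathAlgebra k Q) := ⟨fun a b => ⟨fun i j => ∑ l, concat (a.comp i l) (b.comp l j)⟩⟩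

/-- The unit is the sum of the trivial paths. -/
instance : One (PathAlgebra k Q) :=
  ⟨⟨fun i j => if h : i = j then Finsupp.single (Quiver.Path.nil.cast rfl h) 1 else 0⟩⟩

theorem mul_comp (a b : PathAlgebra k Q) (i j : Q) :
    (a * b).comp i j = ∑ l, concat (a.comp i l) (b.comp l j) := rfl

theorem one_comp_self (i : Q) :
    (1 : PathAlgebra k Q).comp i i = Finsupp.single Quiver.Path.nil 1 :=
  dif_pos rfl

theorem one_comp_of_ne {i j : Q} (h : i ≠ j) : (1 : PathAlgebra k Q).comp i j = 0 :=
  dif_neg h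

theorem add_comp (a b : PathAlgebra k Q) (i j : Q) :
    (a + b).comp i j = a.comp i j + b.comp i j := rfl

theorem zero_comp (i j : Q) : (0 : PathAlgebra k Q).comp i j = 0 := rfl

theorem smul_comp (c : k) (a : PathAlgebra k Q) (i j : Q) : (c • a).comp i j = c • a.comp i j :=
  rfl

instance : Ring (PathAlgebra k Q) :=
  { (inferInstance : AddCommGroup (PathAlgebra k Q)) with
    mul := (· * ·)
    one := 1
    mul_assoc := fun a b c => by
      ext1
      funext i j
      simp only [mul_comp, map_sum, LinearMap.sum_apply, concat_assoc]
      exact Finset.sum_comm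
    one_mul := fun a => by
      ext1
      funext i j
      rw [mul_comp, Finset.sum_eq_single i]
      · rw [one_comp_self, nil_concat]
      · intro l _ hl
        rw [one_comp_of_ne hl.symm, map_zero, LinearMap.zero_apply]
      · simp
    mul_one := fun a => by
      ext1
      funext i j
      rw [mul_comp, Finset.sum_eq_single j]
      · rw [one_comp_self, concat_nil]
      · intro l _ hl
        rw [one_comp_of_ne hl, map_zero]
      · simp
    left_distrib := fun a b c => by
      ext1
      funext i j
      simp only [mul_comp, add_comp, map_add, Finset.sum_add_distrib]
    right_distrib := fun a b c => by
      ext1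
      funext i j
      simp only [mul_comp, add_comp, map_add, LinearMap.add_apply, Finset.sum_add_distrib]
    zero_mul := fun a => by
      ext1
      funext i j
      simp only [mul_comp, zero_comp, map_zero, LinearMap.zero_apply, Finset.sum_const_zero]
    mul_zero := fun a => by
      ext1
      funext i j
      simp only [mul_comp, zero_comp, map_zero, Finset.sum_const_zero] }

instance : Algebra k (PathAlgebra k Q) :=
  Algebra.ofModule
    (fun c a b => by
      ext1
      funext i j
      simp only [mul_comp, smul_comp, map_smul, LinearMap.smul_apply, Finset.smul_sum])
    (fun c a b => by
      ext1
      funext i j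
      simp only [mul_comp, smul_comp, map_smul, Finset.smul_sum])

end PathAlgebra

/-! ### Brauer configurations -/

/-- A Brauer configuration with vertex set `V` and finitely many polygons, indexed by `ι`, all of
whose vertices are non-truncated. -/
structure BrauerConfiguration (V : Type u) [DecidableEq V] (ι : Type v) [Fintype ι]
    [DecidableEq ι] where
  /-- The polygons: finite multisets of vertices. -/
  polygon : ι → Multiset V
  /-- Each polygon has more than one element, counted with multiplicity. -/
  one_lt_card : ∀ i, 1 < (polygon i).card
  /-- The multiplicity function. -/
  μ : V → ℕ
  /-- Multiplicities are positive. -/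
  μ_pos : ∀ a, 0 < μ a
  /-- The orientation: the successor sequence of each vertex `a`, that is, the list of the polygons
  containing `a`. The cyclic order at `a` is obtained by letting the first
  entry follow the last one. -/
  succSeq : V → List ι
  /-- A polygon is listed as many times as `a` occurs in it. -/
  count_succSeq : ∀ a i, (succSeq a).count i = (polygon i).count a
  /-- Every vertex is non-truncated: `μ(a) val(a) > 1`. -/
  nontruncated : ∀ a, 1 < μ a * ∑ i, (polygon i).count a

namespace BrauerConfiguration

variable {V : Type u} [DecidableEq V] {ι : Type v} [Fintype ι] [DecidableEq ι]
  (Γ : BrauerConfiguration V ι)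

/-- The valency of a vertex: its number of occurrences in all polygons. -/
def val (a : V) : ℕ := ∑ i, (Γ.polygon i).count a

theorem length_succSeq (a : V) : (Γ.succSeq a).length = Γ.val a := by
  unfold val
  simp_rw [← Γ.count_succSeq]
  have h := Multiset.sum_count_eq_card (s := Finset.univ) (m := (Γ.succSeq a : Multiset ι))
    (fun _ _ => Finset.mem_univ _)
  simpa using h.symm

/-- The places of the circular orders: a vertex `a` together with a place in its successor sequence,
i.e. an occurrence of `a` in a polygon. Each of them is the start of one arrow of the
Brauer quiver, so this is also the set of arrows. -/
def Place : Type u := Σ a : V, Fin (Γ.succSeq a).length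

variable {Γ} in
/-- The polygon at a given place. -/
def Place.poly (x : Γ.Place) : ι := (Γ.succSeq x.1).get x.2

variable {Γ} in
/-- The place following `x` in the circular order. -/
def Place.next (x : Γ.Place) : Γ.Place :=
  ⟨x.1, ⟨(x.2 + 1) % (Γ.succSeq x.1).length, Nat.mod_lt _ (Nat.zero_lt_of_lt x.2.isLt)⟩⟩

/-- The vertices of the Brauer quiver are the polygons. -/
def QVertex (_ : BrauerConfiguration V ι) : Type v := ι

instance : Fintype Γ.QVertex := inferInstanceAs (Fintype ι)
instance : DecidableEq Γ.QVertex := inferInstanceAs (DecidableEq ι)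

/-- The Brauer quiver: one arrow for each place `x`, from the polygon at `x` to the polygon
at the following place. -/
instance : Quiver Γ.QVertex where
  Hom i j := {x : Γ.Place // x.poly = i ∧ x.next.poly = j}

variable {Γ} in
/-- The arrow of the Brauer quiver that starts at the place `x`. -/
def Place.hom (x : Γ.Place) :
    (show Γ.QVertex from x.poly) ⟶ (show Γ.QVertex from x.next.poly) := ⟨x, rfl, rfl⟩

variable (k : Type w) [Field k]

variable {Γ} in
/-- The arrow that starts at `x`, as an element of the path algebra of the Brauer quiver. -/
def Place.arrow (x : Γ.Place) : PathAlgebra k Γ.QVertex :=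
  PathAlgebra.ofPath x.hom.toPath

variable {Γ} in
/-- The special cycle that starts at `x`: the path that runs once around the circular order. -/
def Place.cycle (x : Γ.Place) : PathAlgebra k Γ.QVertex :=
  ((List.range (Γ.val x.1)).map fun t => (Place.next^[t] x).arrow k).prod

/-- The relations of the Brauer configuration algebra. -/
inductive Relations : Set (PathAlgebra k Γ.QVertex)
  /-- Powers of special cycles at the same polygon are identified. -/
  | cycle_sub (x y : Γ.Place) (h : x.poly = y.poly) :
      Relations (x.cycle k ^ Γ.μ x.1 - y.cycle k ^ Γ.μ y.1)
  /-- The power of a special cycle followed by its first arrow. -/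
  | cycle_mul (x : Γ.Place) : Relations (x.cycle k ^ Γ.μ x.1 * x.arrow k)
  /-- Composable arrows that are not consecutive in a special cycle. -/
  | arrow_mul (x y : Γ.Place) (h : x.next.poly = y.poly) (hne : y ≠ x.next) :
      Relations (x.arrow k * y.arrow k)

/-- The Brauer configuration algebra: the quotient of the path algebra of the Brauer quiver by the
two-sided ideal generated by the relations. -/
abbrev BrauerAlgebra : Type _ := RingQuot fun a b => a ∈ Γ.Relations k ∧ b = 0

/-- A Brauer configuration is connected if any two polygons are linked by a chain of polygons in
which consecutive ones have a common vertex. -/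
def IsConnected : Prop :=
  (SimpleGraph.fromRel fun i j => ∃ a, a ∈ Γ.polygon i ∧ a ∈ Γ.polygon j).Connected

end BrauerConfiguration

/-! ### The Vigenère cryptosystem -/

namespace Vigenere

variable {m n N : ℕ} [NeZero m]

/-- Vigenère encryption over the alphabet `ℤ/n` with key `K` of length `m` of a plaintext `x` of
length `N`: the key is repeated periodically and added. -/
def encrypt (K : Fin m → ZMod n) (x : Fin N → ZMod n) : Fin N → ZMod n :=
  fun t => x t + K (Fin.ofNat m t.val)

/-- The `i`-th list of a text `y`: its letters at the positions congruent to `i` modulo `m`. -/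
def block (m : ℕ) [NeZero m] (y : Fin N → ZMod n) (i : Fin m) : List (ZMod n) :=
  ((List.finRange N).filter fun t : Fin N => Fin.ofNat m t.val = i).map y

theorem sum_count_block (y : Fin N → ZMod n) (j : ZMod n) :
    ∑ i, (block m y i).count j = (List.ofFn y).count j := by
  rw [List.ofFn_eq_map]
  unfold block
  induction List.finRange N with
  | nil => simp
  | cons t l ih =>
    rw [List.map_cons, List.count_cons, ← ih]
    have h : ∀ i : Fin m, (((t :: l).filter fun t : Fin N => Fin.ofNat m t.val = i).map y).count j =
        ((l.filter fun t : Fin N => Fin.ofNat m t.val = i).map y).count j +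
          if i = Fin.ofNat m t.val then (if y t == j then 1 else 0) else 0 := by
      intro i
      by_cases hi : Fin.ofNat m t.val = i
      · rw [List.filter_cons_of_pos (by simpa using hi), List.map_cons, List.count_cons,
          if_pos hi.symm]
      · rw [List.filter_cons_of_neg (by simpa using hi), if_neg (Ne.symm hi), Nat.add_zero]
    simp only [h, Finset.sum_add_distrib]
    simp

/-- The Brauer configuration of a text `y` and a key length `m`: the vertices are the letters, the
polygons are the lists `y₁, …, yₘ`, all multiplicities are `1`, and the successor
sequences are ordered by `y₁ < ⋯ < yₘ`. -/
def configuration (m : ℕ) [NeZero m] (y : Fin N → ZMod n)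
    (hlen : ∀ i, 1 < (block m y i).length) (hfreq : ∀ j, 1 < (List.ofFn y).count j) :
    BrauerConfiguration (ZMod n) (Fin m) where
  polygon i := (block m y i : Multiset (ZMod n))
  one_lt_card i := by simpa using hlen i
  μ _ := 1
  μ_pos _ := Nat.one_pos
  succSeq j := (List.finRange m).flatMap fun i => List.replicate ((block m y i).count j) i
  count_succSeq j i := by
    rw [List.count_flatMap, ← List.ofFn_eq_map, List.sum_ofFn]
    simp [List.count_replicate]
  nontruncated j := by
    have h := hfreq j
    rw [← sum_count_block (m := m)] at h
    simpa using h

end Vigenere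

end

/-!
The normal words of `Γ` are the trivial paths, the proper nontrivial pieces of the powers
`C ^ μ(a)` of special cycles, and one socle word for each polygon. Left multiplication by the
generators is a well-defined action on formal combinations of normal words, so the normal words are
a basis of the Brauer configuration algebra, and multiplication by an arrow shifts coefficients. An
element is therefore central if and only if its coefficients are constant along certain orbits and
zero elsewhere, and a basis of the center consists of `1`, the socle elements, the powers of special
cycles summed over the places of a vertex, and, for each loop `x` of the quiver, the complement of
`x` in `C ^ μ(a)`. If `μ = 1`, no powers of special cycles remain, and it is left to count loops: in
a sorted successor sequence with at least two distinct entries, the places whose polygon differs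
from the next one are the last occurrences of the polygons in the sequence.
-/

noncomputable section

universe u v w

theorem finrank_eq_card_of_biorthogonal {k M κ : Type*} [Ring k] [StrongRankCondition k]
    [AddCommGroup M] [Module k M] [Fintype κ] [DecidableEq κ] {Z : Submodule k M} (v : κ → M)
    (f : κ → M →ₗ[k] k) (mem : ∀ j, v j ∈ Z)
    (biorthogonal : ∀ i j, f i (v j) = if i = j then 1 else 0)
    (separating : ∀ z ∈ Z, (∀ i, f i z = 0) → z = 0) :
    Module.finrank k Z = Fintype.card κ := by
  have eval_sum (c : κ → k) (i : κ) : f i (∑ j, c j • v j) = c i := by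
    simp [biorthogonal]
  have bijective : Function.Bijective (LinearMap.pi f ∘ₗ Z.subtype) := by
    refine ⟨(injective_iff_map_eq_zero _).2 fun z hz =>
      Subtype.ext (separating z z.2 fun i => congrFun hz i), fun c => ?_⟩
    exact ⟨⟨∑ j, c j • v j, Z.sum_mem fun j _ => Z.smul_mem _ (mem j)⟩, funext (eval_sum c)⟩
  rw [(LinearEquiv.ofBijective _ bijective).finrank_eq, Module.finrank_fintype_fun_eq_card]

/-! ### The universal property of the path algebra -/

namespace PathAlgebra

variable {k : Type u} [Field k] {Q : Type v} [Quiver.{w} Q]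

/-- An element of the path algebra as the family of its components. -/
def compEquiv : PathAlgebra k Q ≃ₗ[k] ∀ i j : Q, Quiver.Path i j →₀ k where
  toFun := comp
  map_add' _ _ := rfl
  map_smul' _ _ := rfl
  invFun := mk
  left_inv _ := rfl
  right_inv _ := rfl

section PathValue

variable {A : Type*} [Semiring A]

/-- The value of a path under an assignment of values to vertices and arrows. -/
def pathValue (e : Q → A) (f : ∀ ⦃i j : Q⦄, (i ⟶ j) → A) {i : Q} : ∀ {j : Q}, Quiver.Path i j → A
  | _, .nil => e i
  | _, .cons p a => pathValue e f p * f a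

variable {e : Q → A} {f : ∀ ⦃i j : Q⦄, (i ⟶ j) → A}

theorem pathValue_mul_vertex (he : OrthogonalIdempotents e)
    (hf : ∀ ⦃i j⦄ (a : i ⟶ j), f a * e j = f a) {i j : Q} (p : Quiver.Path i j) :
    pathValue e f p * e j = pathValue e f p := by
  cases p with
  | nil => exact he.idem i
  | cons p a => rw [pathValue, mul_assoc, hf]

theorem vertex_mul_pathValue (he : OrthogonalIdempotents e) {i j : Q}
    (p : Quiver.Path i j) : e i * pathValue e f p = pathValue e f p := by
  induction p with
  | nil => exact he.idem i
  | cons p a ih => rw [pathValue, ← mul_assoc, ih]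

theorem pathValue_comp (he : OrthogonalIdempotents e)
    (hf : ∀ ⦃i j⦄ (a : i ⟶ j), f a * e j = f a) {i j l : Q} (p : Quiver.Path i j)
    (q : Quiver.Path j l) : pathValue e f (p.comp q) = pathValue e f p * pathValue e f q := by
  induction q with
  | nil => exact (pathValue_mul_vertex he hf p).symm
  | cons q a ih => rw [Quiver.Path.comp_cons, pathValue, pathValue, ih, mul_assoc]

theorem pathValue_mul_pathValue_of_ne (he : OrthogonalIdempotents e)
    (hf : ∀ ⦃i j⦄ (a : i ⟶ j), f a * e j = f a) {i j j' l : Q} (p : Quiver.Path i j)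
    (q : Quiver.Path j' l) (h : j ≠ j') : pathValue e f p * pathValue e f q = 0 := by
  rw [← pathValue_mul_vertex he hf p, ← vertex_mul_pathValue he q, mul_assoc, ← mul_assoc (e j),
    he.ortho h, zero_mul, mul_zero]

end PathValue

variable [DecidableEq Q]

theorem ofPath_comp_self {i j : Q} (p : Quiver.Path i j) :
    (ofPath p : PathAlgebra k Q).comp i j = Finsupp.single p 1 :=
  dif_pos ⟨rfl, rfl⟩

theorem ofPath_comp_of_ne {i j i' j' : Q} (p : Quiver.Path i j) (h : ¬(i = i' ∧ j = j')) :
    (ofPath p : PathAlgebra k Q).comp i' j' = 0 :=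
  dif_neg h

variable [Fintype Q]

variable (k Q) in
/-- The basis of the path algebra that consists of the paths. -/
def pathBasis : Module.Basis (Σ i j : Q, Quiver.Path i j) k (PathAlgebra k Q) :=
  (Pi.basis fun _ => Pi.basis fun _ => Finsupp.basisSingleOne).map compEquiv.symm

theorem pathBasis_apply (b : Σ i j : Q, Quiver.Path i j) :
    pathBasis k Q b = ofPath b.2.2 := by
  obtain ⟨i, j, p⟩ := b
  refine comp_injective (funext₂ fun i' j' => ?_)
  simp only [pathBasis, Module.Basis.map_apply, Pi.basis_apply, Finsupp.coe_basisSingleOne]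
  change Pi.single (M := fun i => ∀ j, Quiver.Path i j →₀ k) i
    (Pi.single j (Finsupp.single p 1)) i' j' = _
  by_cases hi : i = i'
  · subst hi
    rw [Pi.single_eq_same]
    by_cases hj : j = j'
    · subst hj
      rw [Pi.single_eq_same, ofPath_comp_self]
    · rw [Pi.single_eq_of_ne' hj, ofPath_comp_of_ne p fun h => hj h.2]
  · rw [Pi.single_eq_of_ne' hi, ofPath_comp_of_ne p fun h => hi h.1, Pi.zero_apply]

theorem linearMap_ext {M : Type*} [AddCommMonoid M] [Module k M] {f g : PathAlgebra k Q →ₗ[k] M}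
    (h : ∀ {i j : Q} (p : Quiver.Path i j), f (ofPath p) = g (ofPath p)) : f = g :=
  (pathBasis k Q).ext fun b => by simpa only [pathBasis_apply] using h b.2.2

theorem ofPath_mul_ofPath {i j l : Q} (p : Quiver.Path i j) (q : Quiver.Path j l) :
    (ofPath p * ofPath q : PathAlgebra k Q) = ofPath (p.comp q) := by
  ext1
  funext i' l'
  rw [mul_comp, Finset.sum_eq_single j]
  · by_cases h : i = i' ∧ l = l'
    · obtain ⟨rfl, rfl⟩ := h
      simp only [ofPath_comp_self, concat_single, mul_one]
    · rw [ofPath_comp_of_ne _ h]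
      rcases not_and_or.1 h with hi | hl
      · rw [ofPath_comp_of_ne p fun h' => hi h'.1, map_zero, LinearMap.zero_apply]
      · rw [ofPath_comp_of_ne q fun h' => hl h'.2, map_zero]
  · intro r _ hr
    rw [ofPath_comp_of_ne p fun h => hr h.2.symm, map_zero, LinearMap.zero_apply]
  · simp

theorem ofPath_mul_ofPath_of_ne {i j j' l : Q} (p : Quiver.Path i j) (q : Quiver.Path j' l)
    (h : j ≠ j') : (ofPath p * ofPath q : PathAlgebra k Q) = 0 := by
  ext1
  funext i' l'
  rw [mul_comp, zero_comp]
  refine Finset.sum_eq_zero fun r _ => ?_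
  by_cases hr : j = r
  · rw [ofPath_comp_of_ne q fun h' => h (hr.trans h'.1.symm), map_zero]
  · rw [ofPath_comp_of_ne p fun h' => hr h'.2, map_zero, LinearMap.zero_apply]

theorem completeOrthogonalIdempotents_nil :
    CompleteOrthogonalIdempotents fun i : Q =>
      (ofPath (Quiver.Path.nil : Quiver.Path i i) : PathAlgebra k Q) where
  idem i := by rw [IsIdempotentElem, ofPath_mul_ofPath, Quiver.Path.comp_nil]
  ortho i j h := ofPath_mul_ofPath_of_ne _ _ h
  complete := by
    refine compEquiv.injective (funext₂ fun i j => ?_)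
    rw [map_sum, Finset.sum_apply, Finset.sum_apply]
    change ∑ l, (ofPath (Quiver.Path.nil : Quiver.Path l l)).comp i j = comp 1 i j
    by_cases h : i = j
    · subst h
      rw [one_comp_self, Finset.sum_eq_single i, ofPath_comp_self]
      · exact fun l _ hl => ofPath_comp_of_ne _ fun h => hl h.1
      · simp
    · rw [one_comp_of_ne h]
      exact Finset.sum_eq_zero fun l _ => ofPath_comp_of_ne _ fun h' => h (h'.1.symm.trans h'.2)

section Lift

variable {A : Type*} [Ring A] [Algebra k A] {e : Q → A} {f : ∀ ⦃i j : Q⦄, (i ⟶ j) → A}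

theorem constr_pathValue_ofPath {i j : Q} (p : Quiver.Path i j) :
    (pathBasis k Q).constr k (fun b => pathValue e f b.2.2) (ofPath p) = pathValue e f p := by
  rw [← pathBasis_apply ⟨i, j, p⟩, Module.Basis.constr_basis]

/-- The universal property of the path algebra: complete orthogonal idempotents indexed by the
vertices, together with compatible values of the arrows, extend to an algebra homomorphism. -/
def lift (he : CompleteOrthogonalIdempotents e) (hf : ∀ ⦃i j⦄ (a : i ⟶ j), f a * e j = f a) :
    PathAlgebra k Q →ₐ[k] A :=
  AlgHom.ofLinearMap ((pathBasis k Q).constr k fun b => pathValue e f b.2.2)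
    (by
      rw [← completeOrthogonalIdempotents_nil.complete, map_sum, ← he.complete]
      exact Finset.sum_congr rfl fun i _ => constr_pathValue_ofPath _)
    (LinearMap.map_mul_iff _ |>.2 <| linearMap_ext fun {i j} p => linearMap_ext fun {j' l} q => by
      simp only [LinearMap.compr₂_apply, LinearMap.mul_apply', LinearMap.compl₂_apply,
        LinearMap.comp_apply, constr_pathValue_ofPath]
      by_cases h : j = j'
      · subst h
        rw [ofPath_mul_ofPath, constr_pathValue_ofPath,
          pathValue_comp he.toOrthogonalIdempotents hf]
      · rw [ofPath_mul_ofPath_of_ne _ _ h, map_zero,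
          pathValue_mul_pathValue_of_ne he.toOrthogonalIdempotents hf _ _ h])

theorem lift_nil (he : CompleteOrthogonalIdempotents e)
    (hf : ∀ ⦃i j⦄ (a : i ⟶ j), f a * e j = f a) (i : Q) :
    lift (k := k) he hf (ofPath (Quiver.Path.nil : Quiver.Path i i)) = e i :=
  constr_pathValue_ofPath _

theorem lift_toPath (he : CompleteOrthogonalIdempotents e)
    (hf : ∀ ⦃i j⦄ (a : i ⟶ j), f a * e j = f a) {i j : Q} (a : i ⟶ j) (ha : e i * f a = f a) :
    lift (k := k) he hf (ofPath a.toPath) = f a :=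
  (constr_pathValue_ofPath _).trans ha

end Lift

end PathAlgebra

namespace BrauerConfiguration

variable {V : Type u} [DecidableEq V] {ι : Type v} [Fintype ι] [DecidableEq ι]
  {Γ : BrauerConfiguration V ι}

instance : DecidableEq Γ.Place := inferInstanceAs (DecidableEq (Σ a : V, Fin (Γ.succSeq a).length))

instance [Fintype V] : Fintype Γ.Place :=
  inferInstanceAs (Fintype (Σ a : V, Fin (Γ.succSeq a).length))

variable (Γ) in
/-- The length `μ(a) val(a)` of the powers of special cycles at the vertex `a` that are identified
in the Brauer configuration algebra. -/
def cycleLength (a : V) : ℕ := Γ.μ a * Γ.val a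

theorem one_lt_cycleLength (a : V) : 1 < Γ.cycleLength a := Γ.nontruncated a

theorem cycleLength_pos (a : V) : 0 < Γ.cycleLength a := Nat.zero_lt_of_lt (one_lt_cycleLength a)

theorem cycleLength_sub_one_pos (a : V) : 0 < Γ.cycleLength a - 1 :=
  Nat.sub_pos_of_lt (one_lt_cycleLength a)

theorem val_pos (a : V) : 0 < Γ.val a := Nat.pos_of_mul_pos_left (cycleLength_pos a)

theorem exists_place_of_mem {i : ι} {a : V} (ha : a ∈ Γ.polygon i) :
    ∃ x : Γ.Place, x.1 = a ∧ x.poly = i := by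
  have hmem : i ∈ Γ.succSeq a := by
    rw [← List.count_pos_iff, Γ.count_succSeq]
    exact Multiset.count_pos.2 ha
  obtain ⟨t, ht⟩ := List.get_of_mem hmem
  exact ⟨⟨a, t⟩, rfl, ht⟩

namespace Place

/-- The polygon at a place, as a vertex of the Brauer quiver. -/
def source (x : Γ.Place) : Γ.QVertex := x.poly

theorem source_surjective : Function.Surjective (source : Γ.Place → Γ.QVertex) := fun i => by
  obtain ⟨a, ha⟩ := Multiset.card_pos_iff_exists_mem.1 (Nat.zero_lt_of_lt (Γ.one_lt_card i))
  obtain ⟨x, -, hx⟩ := exists_place_of_mem ha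
  exact ⟨x, hx⟩

theorem ext {x y : Γ.Place} (fst_eq : x.1 = y.1) (snd_eq : (x.2 : ℕ) = y.2) : x = y := by
  obtain ⟨a, s⟩ := x
  obtain ⟨b, t⟩ := y
  obtain rfl : a = b := fst_eq
  exact congrArg (Sigma.mk a) (Fin.ext snd_eq)

theorem next_fst (x : Γ.Place) : x.next.1 = x.1 := rfl

theorem next_iterate_fst (x : Γ.Place) (n : ℕ) : (next^[n] x).1 = x.1 := by
  induction n with
  | zero => rfl
  | succ n ih => rw [Function.iterate_succ_apply', next_fst, ih]

theorem next_iterate_snd (x : Γ.Place) (n : ℕ) :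
    ((next^[n] x).2 : ℕ) = (x.2 + n) % (Γ.succSeq x.1).length := by
  induction n with
  | zero => exact (Nat.mod_eq_of_lt x.2.isLt).symm
  | succ n ih =>
    rw [Function.iterate_succ_apply']
    simp only [next, ih, next_iterate_fst, Nat.mod_add_mod, add_assoc]

theorem next_iterate_eq_self_iff (x : Γ.Place) (n : ℕ) : next^[n] x = x ↔ Γ.val x.1 ∣ n := by
  have snd_eq_iff : ((next^[n] x).2 : ℕ) = x.2 ↔ Γ.val x.1 ∣ n := by
    rw [next_iterate_snd, ← Γ.length_succSeq, ← Nat.add_modEq_left_iff (a := (x.2 : ℕ)),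
      Nat.ModEq, Nat.mod_eq_of_lt x.2.isLt]
  exact ⟨fun h => snd_eq_iff.1 (by rw [h]),
    fun h => ext (next_iterate_fst x n) (snd_eq_iff.2 h)⟩

theorem next_iterate_cycleLength (x : Γ.Place) : next^[Γ.cycleLength x.1] x = x :=
  (next_iterate_eq_self_iff _ _).2 (Nat.dvd_mul_left _ _)

theorem next_iterate_val (x : Γ.Place) : next^[Γ.val x.1] x = x :=
  (next_iterate_eq_self_iff _ _).2 dvd_rfl

theorem next_iterate_val_sub_one_next (x : Γ.Place) : next^[Γ.val x.1 - 1] x.next = x := by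
  rw [← Function.iterate_succ_apply, Nat.succ_eq_add_one, Nat.sub_add_cancel (val_pos x.1),
    next_iterate_val]

theorem next_iterate_cycleLength_sub_one_next (x : Γ.Place) :
    next^[Γ.cycleLength x.1 - 1] x.next = x := by
  rw [← Function.iterate_succ_apply, Nat.succ_eq_add_one, Nat.sub_add_cancel (cycleLength_pos _),
    next_iterate_cycleLength]

theorem next_injective : Function.Injective (next : Γ.Place → Γ.Place) := by
  intro x y h
  have fst_eq : x.next.1 = y.next.1 := congrArg Sigma.fst h
  rw [← next_iterate_val_sub_one_next x, ← next_iterate_val_sub_one_next y, h,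
    ← next_fst x, fst_eq, next_fst]

theorem next_surjective : Function.Surjective (next : Γ.Place → Γ.Place) := fun x =>
  ⟨next^[Γ.val x.1 - 1] x, (Function.iterate_succ_apply' next _ x).symm.trans
    (next_iterate_val_sub_one_next x)⟩

theorem exists_next_iterate_eq {x y : Γ.Place} (h : x.1 = y.1) : ∃ n, next^[n] x = y := by
  have hx := x.2.isLt
  have hy : (y.2 : ℕ) < (Γ.succSeq x.1).length := by rw [h]; exact y.2.isLt
  refine ⟨y.2 + ((Γ.succSeq x.1).length - x.2), ext ((next_iterate_fst _ _).trans h) ?_⟩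
  rw [next_iterate_snd, show (x.2 + (y.2 + ((Γ.succSeq x.1).length - x.2)) : ℕ) =
    y.2 + (Γ.succSeq x.1).length by omega, Nat.add_mod_right, Nat.mod_eq_of_lt hy]

end Place

theorem IsConnected.eq_of_forall_next (hΓ : Γ.IsConnected) {α : Type*} {g : Γ.QVertex → α}
    (hg : ∀ x : Γ.Place, g x.next.source = g x.source) (i j : Γ.QVertex) : g i = g j := by
  have iterate_eq (n : ℕ) (x : Γ.Place) : g (Place.next^[n] x).source = g x.source := by
    induction n with
    | zero => rfl
    | succ n ih => rw [Function.iterate_succ_apply', hg, ih]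
  have eq_of_common_vertex {i j : ι} (h : ∃ a, a ∈ Γ.polygon i ∧ a ∈ Γ.polygon j) :
      g i = g j := by
    obtain ⟨a, hi, hj⟩ := h
    obtain ⟨x, rfl, rfl⟩ := exists_place_of_mem hi
    obtain ⟨y, hy, rfl⟩ := exists_place_of_mem hj
    obtain ⟨n, rfl⟩ := Place.exists_next_iterate_eq hy.symm
    exact (iterate_eq n x).symm
  induction (SimpleGraph.reachable_iff_reflTransGen i j).1 (hΓ.preconnected i j) with
  | refl => rfl
  | tail _ hadj ih =>
    obtain ⟨-, h | h⟩ := hadj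
    · exact ih.trans (eq_of_common_vertex h)
    · exact ih.trans (eq_of_common_vertex h).symm

/-- The product of the values of `n` consecutive places, starting at `x`. -/
def runProd {A : Type*} [Monoid A] (f : Γ.Place → A) (x : Γ.Place) (n : ℕ) : A :=
  ((List.range n).map fun t => f (Place.next^[t] x)).prod

section runProd

variable {A B : Type*} [Monoid A] [Monoid B] (f : Γ.Place → A)

theorem runProd_zero (x : Γ.Place) : runProd f x 0 = 1 := rfl

theorem runProd_succ (x : Γ.Place) (n : ℕ) :
    runProd f x (n + 1) = f x * runProd f x.next n := by
  simp [runProd, List.range_succ_eq_map, Function.comp_def]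

theorem runProd_succ' (x : Γ.Place) (n : ℕ) :
    runProd f x (n + 1) = runProd f x n * f (Place.next^[n] x) := by
  simp [runProd, List.range_succ]

theorem runProd_add (x : Γ.Place) (n r : ℕ) :
    runProd f x (n + r) = runProd f x n * runProd f (Place.next^[n] x) r := by
  simp [runProd, List.range_add, Function.comp_def, ← Function.iterate_add_apply, Nat.add_comm]

theorem runProd_val_pow (x : Γ.Place) (m : ℕ) :
    runProd f x (Γ.val x.1) ^ m = runProd f x (m * Γ.val x.1) := by
  induction m with
  | zero => rw [pow_zero, Nat.zero_mul, runProd_zero]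
  | succ m ih => rw [pow_succ', ih, Nat.succ_mul, Nat.add_comm, runProd_add, x.next_iterate_val]

theorem map_runProd {F : Type*} [FunLike F A B] [MonoidHomClass F A B] (g : F)
    (x : Γ.Place) (n : ℕ) : g (runProd f x n) = runProd (fun y => g (f y)) x n := by
  simp [runProd, map_list_prod, Function.comp_def]

end runProd

/-- The paths of length `n` that start at the places `x` and `y` and follow their circular orders
are equal: a trivial path remembers only the polygon at which it stays. -/
abbrev SamePath (x y : Γ.Place) (n : ℕ) : Prop := x = y ∨ n = 0 ∧ x.source = y.source

theorem SamePath.source_eq {x y : Γ.Place} {n : ℕ} : SamePath x y n → x.source = y.source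
  | .inl h => congrArg Place.source h
  | .inr h => h.2

theorem SamePath.symm {x y : Γ.Place} {n : ℕ} : SamePath x y n → SamePath y x n :=
  Or.imp Eq.symm (And.imp_right Eq.symm)

theorem samePath_zero_iff {x y : Γ.Place} : SamePath x y 0 ↔ x.source = y.source :=
  ⟨SamePath.source_eq, fun h => .inr ⟨rfl, h⟩⟩

theorem samePath_iff_of_pos {x y : Γ.Place} {n : ℕ} (hn : 0 < n) : SamePath x y n ↔ x = y :=
  or_iff_left fun h => hn.ne' h.1

/-! ### Normal words -/

variable (Γ) in
/-- The normal words: labels of a basis of the Brauer configuration algebra. Here `vertex i` stands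
for the trivial path at `i`, `run x n` for the proper initial piece of length `n` of the power of
the special cycle at `x`, and `socle i` for the common value of these powers at `i`. -/
inductive NormalWord : Type (max u v)
  | vertex (i : Γ.QVertex)
  | run (x : Γ.Place) (n : ℕ) (pos : 0 < n) (lt : n < Γ.cycleLength x.1)
  | socle (i : Γ.QVertex)

namespace NormalWord

/-- The vertex of the Brauer quiver at which a normal word starts. -/
def head : Γ.NormalWord → Γ.QVertex
  | vertex i => i
  | run x _ _ _ => x.source
  | socle i => i

/-- The normal word of the path of length `n` that starts at the place `x`; unlike `run`, it allows
`n = 0`. -/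
def path (x : Γ.Place) (n : ℕ) (h : n < Γ.cycleLength x.1) : Γ.NormalWord :=
  if pos : 0 < n then run x n pos h else vertex x.source

theorem head_path (x : Γ.Place) (n : ℕ) (h : n < Γ.cycleLength x.1) :
    (path x n h).head = x.source := by
  unfold path
  split_ifs <;> rfl

theorem path_inj {x y : Γ.Place} {m n : ℕ} (hm : m < Γ.cycleLength x.1)
    (hn : n < Γ.cycleLength y.1) : path x m hm = path y n hn ↔ m = n ∧ SamePath x y n := by
  obtain rfl | m := m <;> obtain rfl | n := n <;> simp [path, and_comm, samePath_zero_iff]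

theorem path_ne_socle {x : Γ.Place} {n : ℕ} (h : n < Γ.cycleLength x.1) (i : Γ.QVertex) :
    path x n h ≠ socle i := by
  unfold path
  split_ifs <;> exact nofun

end NormalWord

open NormalWord

section Form

variable (k : Type w) [Semiring k]

/-- The normal form of the path of length `n` that starts at the place `x` and follows its
circular order. -/
def pathForm (x : Γ.Place) (n : ℕ) : Γ.NormalWord →₀ k :=
  if h : n < Γ.cycleLength x.1 then Finsupp.single (path x n h) 1
  else if n = Γ.cycleLength x.1 then Finsupp.single (socle x.source) 1 else 0

variable {k}

theorem pathForm_of_lt {x : Γ.Place} {n : ℕ} (h : n < Γ.cycleLength x.1) :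
    pathForm k x n = Finsupp.single (path x n h) 1 := dif_pos h

theorem pathForm_cycleLength (x : Γ.Place) :
    pathForm k x (Γ.cycleLength x.1) = Finsupp.single (socle x.source) 1 := by
  rw [pathForm, dif_neg (lt_irrefl _), if_pos rfl]

theorem pathForm_of_gt {x : Γ.Place} {n : ℕ} (h : Γ.cycleLength x.1 < n) : pathForm k x n = 0 := by
  rw [pathForm, dif_neg h.not_gt, if_neg h.ne']

theorem pathForm_apply_path (x y : Γ.Place) (m n : ℕ) (h : n < Γ.cycleLength y.1) :
    pathForm k x m (path y n h) = if m = n ∧ SamePath x y n then 1 else 0 := by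
  classical
  rcases lt_trichotomy m (Γ.cycleLength x.1) with hm | rfl | hm
  · simp only [pathForm_of_lt hm, Finsupp.single_apply, path_inj]
  · rw [pathForm_cycleLength, Finsupp.single_eq_of_ne (path_ne_socle h _), if_neg]
    rintro ⟨rfl, rfl | ⟨h0, -⟩⟩
    · exact lt_irrefl _ h
    · exact (cycleLength_pos x.1).ne' h0
  · rw [pathForm_of_gt hm, Finsupp.zero_apply, if_neg]
    rintro ⟨rfl, rfl | ⟨rfl, -⟩⟩
    · exact hm.not_gt h
    · exact Nat.not_lt_zero _ hm

theorem pathForm_apply_socle (x : Γ.Place) (n : ℕ) (i : Γ.QVertex) :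
    pathForm k x n (socle i) = if n = Γ.cycleLength x.1 ∧ x.source = i then 1 else 0 := by
  classical
  rcases lt_trichotomy n (Γ.cycleLength x.1) with hn | rfl | hn
  · rw [pathForm_of_lt hn, Finsupp.single_eq_of_ne (path_ne_socle hn i).symm,
      if_neg fun h => hn.ne h.1]
  · simp [pathForm_cycleLength, Finsupp.single_apply]
  · rw [pathForm_of_gt hn, Finsupp.zero_apply, if_neg fun h => hn.ne' h.1]

theorem exists_pathForm_eq_single (b : Γ.NormalWord) :
    ∃ (x : Γ.Place) (n : ℕ), pathForm k x n = Finsupp.single b 1 := by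
  cases b with
  | vertex i =>
    obtain ⟨x, rfl⟩ := Place.source_surjective i
    exact ⟨x, 0, pathForm_of_lt (cycleLength_pos _)⟩
  | run x n pos lt => exact ⟨x, n, by rw [pathForm_of_lt lt, path, dif_pos pos]⟩
  | socle i =>
    obtain ⟨x, rfl⟩ := Place.source_surjective i
    exact ⟨x, _, pathForm_cycleLength x⟩

theorem linearMap_ext_pathForm {M : Type*} [AddCommMonoid M] [Module k M]
    {f g : (Γ.NormalWord →₀ k) →ₗ[k] M}
    (h : ∀ x n, f (pathForm k x n) = g (pathForm k x n)) : f = g :=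
  Finsupp.lhom_ext' fun b => LinearMap.ext_ring <| by
    obtain ⟨x, n, hb⟩ := exists_pathForm_eq_single (k := k) b
    rw [LinearMap.comp_apply, LinearMap.comp_apply, Finsupp.lsingle_apply, ← hb, h]

end Form

section Action

variable (k : Type w) [Semiring k]

/-- Left multiplication by the trivial path at `i`, on normal words. -/
def leftVertex (i : Γ.QVertex) : Module.End k (Γ.NormalWord →₀ k) :=
  Finsupp.linearCombination k fun b => if b.head = i then Finsupp.single b 1 else 0

/-- Left multiplication by the arrow at `y`, on normal words. -/
def leftArrow (y : Γ.Place) : Module.End k (Γ.NormalWord →₀ k) :=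
  Finsupp.linearCombination k fun
    | vertex i => if y.next.source = i then pathForm k y 1 else 0
    | run x n _ _ => if y.next = x then pathForm k y (n + 1) else 0
    | socle _ => 0

variable {k}

theorem leftVertex_single (i : Γ.QVertex) (b : Γ.NormalWord) :
    leftVertex k i (Finsupp.single b 1) = if b.head = i then Finsupp.single b 1 else 0 := by
  rw [leftVertex, Finsupp.linearCombination_single, one_smul]

theorem completeOrthogonalIdempotents_leftVertex :
    CompleteOrthogonalIdempotents (leftVertex k : Γ.QVertex → _) where
  idem i := Finsupp.lhom_ext' fun b => LinearMap.ext_ring <| by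
    by_cases h : b.head = i <;> simp [leftVertex_single, h]
  ortho i j hij := Finsupp.lhom_ext' fun b => LinearMap.ext_ring <| by
    by_cases h : b.head = j <;> simp [leftVertex_single, h, hij.symm]
  complete := Finsupp.lhom_ext' fun b => LinearMap.ext_ring <| by
    simp [leftVertex_single]

theorem leftVertex_pathForm (i : Γ.QVertex) (x : Γ.Place) (n : ℕ) :
    leftVertex k i (pathForm k x n) = if x.source = i then pathForm k x n else 0 := by
  rcases lt_trichotomy n (Γ.cycleLength x.1) with h | rfl | h
  · rw [pathForm_of_lt h, leftVertex_single, head_path]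
  · rw [pathForm_cycleLength, leftVertex_single, head]
  · rw [pathForm_of_gt h, map_zero, ite_self]

theorem leftArrow_pathForm (y x : Γ.Place) (n : ℕ) :
    leftArrow k y (pathForm k x n) =
      if SamePath y.next x n then pathForm k y (n + 1) else 0 := by
  have pathForm_succ_eq_zero (h : Γ.cycleLength x.1 ≤ n) (hs : SamePath y.next x n) :
      pathForm k y (n + 1) = 0 := by
    rw [samePath_iff_of_pos ((cycleLength_pos x.1).trans_le h)] at hs
    exact pathForm_of_gt (Nat.lt_succ_of_le (by rwa [← hs, Place.next_fst] at h))
  rcases lt_trichotomy n (Γ.cycleLength x.1) with h | rfl | h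
  · rw [pathForm_of_lt h, leftArrow, Finsupp.linearCombination_single, one_smul]
    obtain rfl | hn := n.eq_zero_or_pos
    · simp only [path, lt_irrefl, dite_false, samePath_zero_iff]
    · simp only [path, hn, dite_true, samePath_iff_of_pos]
  · rw [pathForm_cycleLength, leftArrow, Finsupp.linearCombination_single, smul_zero,
      eq_comm, ite_eq_right_iff]
    exact pathForm_succ_eq_zero le_rfl
  · rw [pathForm_of_gt h, map_zero, eq_comm, ite_eq_right_iff]
    exact pathForm_succ_eq_zero h.le

theorem leftArrow_mul_leftVertex (y : Γ.Place) :
    leftArrow k y * leftVertex k y.next.source = leftArrow k y :=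
  linearMap_ext_pathForm fun x n => by
    rw [Module.End.mul_apply, leftVertex_pathForm]
    split_ifs with h
    · rfl
    · rw [map_zero, leftArrow_pathForm, if_neg fun hs => h hs.source_eq.symm]

theorem leftVertex_mul_leftArrow (y : Γ.Place) :
    leftVertex k y.source * leftArrow k y = leftArrow k y :=
  linearMap_ext_pathForm fun x n => by
    rw [Module.End.mul_apply, leftArrow_pathForm]
    split_ifs
    · rw [leftVertex_pathForm, if_pos rfl]
    · rw [map_zero]

theorem runProd_leftArrow_pathForm (x z : Γ.Place) (m n : ℕ) :
    runProd (leftArrow k) x (m + 1) (pathForm k z n) =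
      if SamePath (Place.next^[m + 1] x) z n then pathForm k x (m + 1 + n) else 0 := by
  induction m generalizing x with
  | zero =>
    rw [runProd_succ, runProd_zero, mul_one, leftArrow_pathForm, Nat.add_comm n]
    rfl
  | succ m ih =>
    rw [runProd_succ, Module.End.mul_apply, ih, ← Function.iterate_succ_apply]
    split_ifs
    · rw [leftArrow_pathForm, if_pos (.inl rfl), Nat.add_right_comm]
    · rw [map_zero]

theorem runProd_leftArrow_eq_zero (x : Γ.Place) {m : ℕ} (hm : Γ.cycleLength x.1 < m) :
    runProd (leftArrow k) x m = 0 := by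
  obtain ⟨m, rfl⟩ := Nat.exists_eq_add_one.2 (Nat.zero_lt_of_lt hm)
  refine linearMap_ext_pathForm fun z n => ?_
  rw [runProd_leftArrow_pathForm, pathForm_of_gt (Nat.lt_add_right n hm), ite_self,
    LinearMap.zero_apply]

theorem runProd_leftArrow_cycleLength_congr {x y : Γ.Place} (h : x.source = y.source) :
    runProd (leftArrow k) x (Γ.cycleLength x.1) = runProd (leftArrow k) y (Γ.cycleLength y.1) := by
  have apply_pathForm (x z : Γ.Place) (n : ℕ) :
      runProd (leftArrow k) x (Γ.cycleLength x.1) (pathForm k z n) =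
        if SamePath x z n then pathForm k x (Γ.cycleLength x.1 + n) else 0 := by
    simpa only [Nat.sub_add_cancel (cycleLength_pos x.1), x.next_iterate_cycleLength] using
      runProd_leftArrow_pathForm (k := k) x z (Γ.cycleLength x.1 - 1) n
  refine linearMap_ext_pathForm fun z n => ?_
  rw [apply_pathForm, apply_pathForm]
  obtain rfl | hn := n.eq_zero_or_pos
  · simp only [samePath_zero_iff, h, Nat.add_zero, pathForm_cycleLength]
  · simp only [pathForm_of_gt (Nat.lt_add_of_pos_right hn), ite_self]

theorem leftArrow_mul_leftArrow_eq_zero {x y : Γ.Place} (h : y ≠ x.next) :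
    leftArrow k x * leftArrow k y = 0 := by
  refine linearMap_ext_pathForm fun z n => ?_
  rw [Module.End.mul_apply, LinearMap.zero_apply, leftArrow_pathForm]
  split_ifs
  · rw [leftArrow_pathForm, if_neg ((samePath_iff_of_pos n.succ_pos).not.2 h.symm)]
  · rw [map_zero]

end Action

section PathAction

variable {k : Type w} [Field k]

variable (Γ k) in
/-- The path algebra acts on the normal words from the left. -/
def pathAction : PathAlgebra k Γ.QVertex →ₐ[k] Module.End k (Γ.NormalWord →₀ k) :=
  PathAlgebra.lift (Q := Γ.QVertex)
    (f := fun i j (a : {x : Γ.Place // x.poly = i ∧ x.next.poly = j}) => leftArrow k a.1)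
    completeOrthogonalIdempotents_leftVertex fun _ _ a => by
      obtain ⟨y, rfl, rfl⟩ := a
      exact leftArrow_mul_leftVertex y

theorem pathAction_arrow (y : Γ.Place) : pathAction Γ k (y.arrow k) = leftArrow k y :=
  PathAlgebra.lift_toPath _ _ (Place.hom y) (leftVertex_mul_leftArrow y)

theorem pathAction_cycle_pow (x : Γ.Place) :
    pathAction Γ k (x.cycle k ^ Γ.μ x.1) = runProd (leftArrow k) x (Γ.cycleLength x.1) := by
  change pathAction Γ k (runProd (Place.arrow k) x (Γ.val x.1) ^ Γ.μ x.1) = _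
  rw [runProd_val_pow, map_runProd]
  simp only [pathAction_arrow]
  rfl

theorem pathAction_eq_zero_of_mem_relations {a : PathAlgebra k Γ.QVertex}
    (h : a ∈ Γ.Relations k) : pathAction Γ k a = 0 := by
  cases h with
  | cycle_sub x y h =>
    rw [map_sub, pathAction_cycle_pow, pathAction_cycle_pow,
      runProd_leftArrow_cycleLength_congr h, sub_self]
  | cycle_mul x =>
    have h := runProd_succ' (leftArrow k) x (Γ.cycleLength x.1)
    rw [x.next_iterate_cycleLength] at h
    rw [map_mul, pathAction_cycle_pow, pathAction_arrow, ← h,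
      runProd_leftArrow_eq_zero x (Nat.lt_succ_self _)]
  | arrow_mul x y _ hne =>
    rw [map_mul, pathAction_arrow, pathAction_arrow, leftArrow_mul_leftArrow_eq_zero hne]

end PathAction

/-! ### The basis of normal words -/

section BrauerAlgebra

variable {k : Type w} [Field k]

variable (Γ k) in
/-- The projection from the path algebra of the Brauer quiver to the Brauer configuration
algebra. -/
def toBrauer : PathAlgebra k Γ.QVertex →ₐ[k] Γ.BrauerAlgebra k := RingQuot.mkAlgHom k _

theorem toBrauer_surjective : Function.Surjective (toBrauer Γ k) := RingQuot.mkAlgHom_surjective k _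

theorem toBrauer_eq_zero {a : PathAlgebra k Γ.QVertex} (h : a ∈ Γ.Relations k) :
    toBrauer Γ k a = 0 :=
  (RingQuot.mkAlgHom_rel k ⟨h, rfl⟩).trans (map_zero _)

variable (k) in
/-- The class of the trivial path at `i` in the Brauer configuration algebra. -/
def idem (i : Γ.QVertex) : Γ.BrauerAlgebra k :=
  toBrauer Γ k (PathAlgebra.ofPath (Quiver.Path.nil : Quiver.Path i i))

variable (k) in
/-- The class of the arrow that starts at `y` in the Brauer configuration algebra. -/
def arr (y : Γ.Place) : Γ.BrauerAlgebra k := toBrauer Γ k (y.arrow k)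

theorem completeOrthogonalIdempotents_idem :
    CompleteOrthogonalIdempotents (idem k : Γ.QVertex → Γ.BrauerAlgebra k) :=
  PathAlgebra.completeOrthogonalIdempotents_nil.map (toBrauer Γ k).toRingHom

theorem idem_mul_idem (i j : Γ.QVertex) :
    (idem k i * idem k j : Γ.BrauerAlgebra k) = if i = j then idem k i else 0 :=
  completeOrthogonalIdempotents_idem.mul_eq i j

theorem idem_mul_arr (y : Γ.Place) : idem k y.source * arr k y = arr k y := by
  rw [idem, arr, Place.arrow, ← map_mul]
  exact congrArg _ ((PathAlgebra.ofPath_mul_ofPath _ _).trans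
    (congrArg PathAlgebra.ofPath (Quiver.Path.nil_comp _)))

theorem arr_mul_idem (y : Γ.Place) : arr k y * idem k y.next.source = arr k y := by
  rw [idem, arr, Place.arrow, ← map_mul]
  exact congrArg _ (PathAlgebra.ofPath_mul_ofPath _ _)

theorem arr_mul_arr_eq_zero {x y : Γ.Place} (h : x.next ≠ y) : arr k x * arr k y = 0 := by
  by_cases hs : x.next.source = y.source
  · rw [arr, arr, ← map_mul]
    exact toBrauer_eq_zero (.arrow_mul x y hs h.symm)
  · rw [← arr_mul_idem x, ← idem_mul_arr y, mul_assoc, ← mul_assoc (idem k _), idem_mul_idem,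
      if_neg hs, zero_mul, mul_zero]

variable (k) in
/-- The class of the path of length `n` that starts at `x` and follows its circular order. The
factor `idem k x.source` matters only for `n = 0`. -/
def pathElt (x : Γ.Place) (n : ℕ) : Γ.BrauerAlgebra k := idem k x.source * runProd (arr k) x n

theorem pathElt_zero (x : Γ.Place) : pathElt k x 0 = idem k x.source := mul_one _

theorem pathElt_one (x : Γ.Place) : pathElt k x 1 = arr k x := by
  rw [pathElt, runProd_succ, runProd_zero, mul_one, idem_mul_arr]

theorem pathElt_succ (x : Γ.Place) (n : ℕ) :
    pathElt k x (n + 1) = arr k x * pathElt k x.next n := by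
  rw [pathElt, pathElt, runProd_succ, ← mul_assoc, ← mul_assoc, idem_mul_arr, arr_mul_idem]

theorem pathElt_succ' (x : Γ.Place) (n : ℕ) :
    pathElt k x (n + 1) = pathElt k x n * arr k (Place.next^[n] x) := by
  rw [pathElt, pathElt, runProd_succ', mul_assoc]

theorem pathElt_congr {x y : Γ.Place} {n : ℕ} (h : SamePath x y n) :
    pathElt k x n = pathElt k y n := by
  obtain rfl | ⟨rfl, h⟩ := h
  · rfl
  · rw [pathElt_zero, pathElt_zero, h]

theorem idem_mul_pathElt (i : Γ.QVertex) (x : Γ.Place) (n : ℕ) :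
    idem k i * pathElt k x n = if x.source = i then pathElt k x n else 0 := by
  rw [pathElt, ← mul_assoc, idem_mul_idem]
  split_ifs with h h' h'
  · rw [h]
  · exact absurd h.symm h'
  · exact absurd h'.symm h
  · rw [zero_mul]

theorem pathElt_mul_idem (x : Γ.Place) (n : ℕ) (i : Γ.QVertex) :
    pathElt k x n * idem k i = if (Place.next^[n] x).source = i then pathElt k x n else 0 := by
  have mul_idem_self : pathElt k x n * idem k (Place.next^[n] x).source = pathElt k x n := by
    cases n with
    | zero => rw [pathElt_zero]; exact (idem_mul_idem _ _).trans (if_pos rfl)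
    | succ n => rw [pathElt_succ', mul_assoc, Function.iterate_succ_apply', arr_mul_idem]
  rw [← mul_idem_self, mul_assoc, idem_mul_idem]
  split_ifs with h
  · rw [mul_idem_self]
  · rw [mul_zero]

theorem arr_mul_pathElt (y x : Γ.Place) (n : ℕ) :
    arr k y * pathElt k x n = if SamePath y.next x n then pathElt k y (n + 1) else 0 := by
  split_ifs with h
  · rw [pathElt_succ, pathElt_congr h]
  · cases n with
    | zero =>
      rw [pathElt_zero, ← arr_mul_idem, mul_assoc, idem_mul_idem,
        if_neg (samePath_zero_iff.not.1 h), mul_zero]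
    | succ n =>
      rw [pathElt_succ, ← mul_assoc,
        arr_mul_arr_eq_zero ((samePath_iff_of_pos n.succ_pos).not.1 h), zero_mul]

theorem pathElt_zero_mul_arr (x y : Γ.Place) :
    pathElt k x 0 * arr k y = if x.source = y.source then pathElt k y 1 else 0 := by
  rw [pathElt_zero, ← pathElt_one, idem_mul_pathElt]
  exact if_congr eq_comm rfl rfl

theorem pathElt_succ_mul_arr (x y : Γ.Place) (n : ℕ) :
    pathElt k x (n + 1) * arr k y =
      if Place.next^[n + 1] x = y then pathElt k x (n + 2) else 0 := by
  split_ifs with h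
  · rw [pathElt_succ' x (n + 1), h]
  · rw [pathElt_succ', mul_assoc,
      arr_mul_arr_eq_zero (by rwa [Function.iterate_succ_apply'] at h), mul_zero]

theorem pathElt_cycleLength (x : Γ.Place) :
    pathElt k x (Γ.cycleLength x.1) = toBrauer Γ k (x.cycle k ^ Γ.μ x.1) := by
  obtain ⟨n, hn⟩ := Nat.exists_eq_add_one.2 (cycleLength_pos (Γ := Γ) x.1)
  rw [pathElt, hn, runProd_succ, ← mul_assoc, idem_mul_arr, ← runProd_succ, ← hn]
  change _ = toBrauer Γ k (runProd (Place.arrow k) x (Γ.val x.1) ^ Γ.μ x.1)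
  rw [runProd_val_pow, map_runProd]
  rfl

variable (k) in
/-- The common value of the powers of special cycles at the polygon `i` in the Brauer configuration
algebra. -/
def socleElt (i : Γ.QVertex) : Γ.BrauerAlgebra k :=
  pathElt k (Place.source_surjective i).choose
    (Γ.cycleLength (Place.source_surjective i).choose.1)

theorem socleElt_source (x : Γ.Place) : socleElt k x.source = pathElt k x (Γ.cycleLength x.1) := by
  rw [socleElt, pathElt_cycleLength, pathElt_cycleLength, ← sub_eq_zero, ← map_sub]
  exact toBrauer_eq_zero (.cycle_sub _ x (Place.source_surjective x.source).choose_spec)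

theorem pathElt_eq_zero {x : Γ.Place} {n : ℕ} (h : Γ.cycleLength x.1 < n) : pathElt k x n = 0 := by
  induction n, h using Nat.le_induction with
  | base =>
    rw [pathElt_succ', pathElt_cycleLength, x.next_iterate_cycleLength, arr, ← map_mul]
    exact toBrauer_eq_zero (.cycle_mul x)
  | succ n _ ih => rw [pathElt_succ', ih, zero_mul]

theorem exists_pathElt_eq_zero (x : Γ.Place) : ∃ n, pathElt k x n = 0 :=
  ⟨_, pathElt_eq_zero (Nat.lt_succ_self _)⟩

theorem exists_pathElt_eq_toBrauer_ofPath {i j : Γ.QVertex} (p : Quiver.Path i j) :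
    ∃ x n, toBrauer Γ k (PathAlgebra.ofPath p) = pathElt k x n := by
  induction p with
  | nil =>
    obtain ⟨x, rfl⟩ := Place.source_surjective i
    exact ⟨x, 0, (pathElt_zero x).symm⟩
  | cons p a ih =>
    obtain ⟨x, n, hp⟩ := ih
    obtain ⟨y, rfl, rfl⟩ := a
    have map_cons : toBrauer Γ k (PathAlgebra.ofPath (p.cons (Place.hom y))) =
        pathElt k x n * arr k y := by
      rw [← hp, arr, Place.arrow, ← map_mul]
      exact congrArg _ (PathAlgebra.ofPath_mul_ofPath p (Place.hom y).toPath).symm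
    obtain ⟨l, hl⟩ := exists_pathElt_eq_zero (k := k) x
    cases n with
    | zero =>
      rw [pathElt_zero_mul_arr] at map_cons
      split_ifs at map_cons
      exacts [⟨y, 1, map_cons⟩, ⟨x, l, map_cons.trans hl.symm⟩]
    | succ n =>
      rw [pathElt_succ_mul_arr] at map_cons
      split_ifs at map_cons
      exacts [⟨x, n + 2, map_cons⟩, ⟨x, l, map_cons.trans hl.symm⟩]

theorem linearMap_ext_pathElt {M : Type*} [AddCommMonoid M] [Module k M]
    {f g : Γ.BrauerAlgebra k →ₗ[k] M} (h : ∀ x n, f (pathElt k x n) = g (pathElt k x n)) :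
    f = g := by
  have comp_eq : f ∘ₗ (toBrauer Γ k).toLinearMap = g ∘ₗ (toBrauer Γ k).toLinearMap :=
    PathAlgebra.linearMap_ext fun p => by
      obtain ⟨x, n, hp⟩ := exists_pathElt_eq_toBrauer_ofPath (k := k) p
      simpa only [LinearMap.comp_apply, AlgHom.toLinearMap_apply, hp] using h x n
  exact (LinearMap.cancel_right (g := (toBrauer Γ k).toLinearMap) toBrauer_surjective).1 comp_eq

variable (Γ k) in
/-- The Brauer configuration algebra acts on the normal words from the left. -/
def action : Γ.BrauerAlgebra k →ₐ[k] Module.End k (Γ.NormalWord →₀ k) :=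
  RingQuot.liftAlgHom k ⟨pathAction Γ k, by
    rintro a _ ⟨h, rfl⟩
    rw [pathAction_eq_zero_of_mem_relations h, map_zero]⟩

theorem action_toBrauer (a : PathAlgebra k Γ.QVertex) :
    action Γ k (toBrauer Γ k a) = pathAction Γ k a :=
  RingQuot.liftAlgHom_mkAlgHom_apply ..

theorem action_arr (y : Γ.Place) : action Γ k (arr k y) = leftArrow k y :=
  (action_toBrauer _).trans (pathAction_arrow y)

theorem action_idem (i : Γ.QVertex) : action Γ k (idem k i) = leftVertex k i :=
  (action_toBrauer _).trans (PathAlgebra.lift_nil _ _ i)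

variable (Γ k) in
/-- The coordinates of an element of the Brauer configuration algebra with respect to the normal
words: its action on the sum of the trivial paths. -/
def normalForm : Γ.BrauerAlgebra k →ₗ[k] Γ.NormalWord →₀ k :=
  (LinearMap.applyₗ (∑ i, Finsupp.single (vertex i) 1)) ∘ₗ (action Γ k).toLinearMap

theorem normalForm_apply (a : Γ.BrauerAlgebra k) :
    normalForm Γ k a = action Γ k a (∑ i, Finsupp.single (vertex i) 1) := rfl

theorem normalForm_mul (a b : Γ.BrauerAlgebra k) :
    normalForm Γ k (a * b) = action Γ k a (normalForm Γ k b) := by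
  rw [normalForm_apply, map_mul, Module.End.mul_apply, ← normalForm_apply]

theorem normalForm_idem (x : Γ.Place) : normalForm Γ k (idem k x.source) = pathForm k x 0 := by
  simp only [normalForm_apply, action_idem, map_sum, leftVertex_single]
  rw [pathForm_of_lt (cycleLength_pos _)]
  exact (Fintype.sum_eq_single x.source fun i hi => if_neg hi).trans (if_pos rfl)

theorem normalForm_pathElt (x : Γ.Place) (n : ℕ) :
    normalForm Γ k (pathElt k x n) = pathForm k x n := by
  induction n generalizing x with
  | zero => rw [pathElt_zero, normalForm_idem]
  | succ n ih =>
    rw [pathElt_succ, normalForm_mul, ih, action_arr, leftArrow_pathForm, if_pos (.inl rfl)]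

variable (Γ k) in
/-- The element of the Brauer configuration algebra with given coordinates with respect to the
normal words. -/
def ofNormalForm : (Γ.NormalWord →₀ k) →ₗ[k] Γ.BrauerAlgebra k :=
  Finsupp.linearCombination k fun
    | vertex i => idem k i
    | run x n _ _ => pathElt k x n
    | socle i => socleElt k i

theorem ofNormalForm_pathForm (x : Γ.Place) (n : ℕ) :
    ofNormalForm Γ k (pathForm k x n) = pathElt k x n := by
  rcases lt_trichotomy n (Γ.cycleLength x.1) with h | rfl | h
  · rw [pathForm_of_lt h, ofNormalForm, Finsupp.linearCombination_single, one_smul]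
    obtain rfl | hn := n.eq_zero_or_pos
    · simp only [path, lt_irrefl, dite_false, pathElt_zero]
    · simp only [path, hn, dite_true]
  · rw [pathForm_cycleLength, ofNormalForm, Finsupp.linearCombination_single, one_smul]
    exact socleElt_source x
  · rw [pathForm_of_gt h, map_zero, pathElt_eq_zero h]

variable (Γ k) in
/-- The normal words label a basis of the Brauer configuration algebra. -/
def normalFormEquiv : Γ.BrauerAlgebra k ≃ₗ[k] Γ.NormalWord →₀ k :=
  .ofLinearMap (normalForm Γ k) (ofNormalForm Γ k)
    (linearMap_ext_pathForm fun x n => by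
      rw [LinearMap.comp_apply, ofNormalForm_pathForm, normalForm_pathElt, LinearMap.id_apply])
    (linearMap_ext_pathElt fun x n => by
      rw [LinearMap.comp_apply, normalForm_pathElt, ofNormalForm_pathForm, LinearMap.id_apply])

theorem normalForm_injective : Function.Injective (normalForm Γ k) :=
  (normalFormEquiv Γ k).injective

end BrauerAlgebra

section Coefficients

variable {k : Type w} [Field k]

theorem normalForm_arr_mul_apply (a : Γ.BrauerAlgebra k) {x : Γ.Place} {n : ℕ}
    (h : n + 1 < Γ.cycleLength x.1) :
    normalForm Γ k (arr k x * a) (path x (n + 1) h) =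
      normalForm Γ k a (path x.next n (Nat.lt_of_succ_lt h)) := by
  suffices Finsupp.lapply (path x (n + 1) h) ∘ₗ normalForm Γ k ∘ₗ LinearMap.mulLeft k (arr k x) =
      Finsupp.lapply (path x.next n (Nat.lt_of_succ_lt h)) ∘ₗ normalForm Γ k from
    LinearMap.congr_fun this a
  refine linearMap_ext_pathElt fun y m => ?_
  simp only [LinearMap.comp_apply, Finsupp.lapply_apply, LinearMap.mulLeft_apply,
    arr_mul_pathElt, apply_ite (normalForm Γ k), map_zero, normalForm_pathElt,
    pathForm_apply_path]
  split_ifs with hs hm hm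
  · rw [pathForm_apply_path, if_pos ⟨congrArg _ hm.1, .inl rfl⟩]
  · rw [pathForm_apply_path, if_neg fun h => hm ?_]
    obtain rfl : m = n := Nat.succ_injective h.1
    exact ⟨rfl, hs.symm⟩
  · obtain ⟨rfl, hm⟩ := hm
    exact absurd hm.symm hs
  · rfl

theorem normalForm_mul_arr_apply (a : Γ.BrauerAlgebra k) (y : Γ.Place) {x : Γ.Place} {n : ℕ}
    (h : n + 1 < Γ.cycleLength x.1) :
    normalForm Γ k (a * arr k y) (path x (n + 1) h) =
      if Place.next^[n] x = y then normalForm Γ k a (path x n (Nat.lt_of_succ_lt h)) else 0 := by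
  suffices Finsupp.lapply (path x (n + 1) h) ∘ₗ normalForm Γ k ∘ₗ LinearMap.mulRight k (arr k y) =
      if Place.next^[n] x = y then
        Finsupp.lapply (path x n (Nat.lt_of_succ_lt h)) ∘ₗ normalForm Γ k else 0 by
    have := LinearMap.congr_fun this a
    split_ifs at this ⊢ <;> exact this
  refine linearMap_ext_pathElt fun z m => ?_
  simp only [LinearMap.comp_apply, Finsupp.lapply_apply, LinearMap.mulRight_apply]
  cases m with
  | zero =>
    rw [pathElt_zero_mul_arr]
    split_ifs <;> simp only [map_zero, normalForm_pathElt, pathForm_apply_path,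
      LinearMap.comp_apply, Finsupp.lapply_apply, LinearMap.zero_apply, Finsupp.zero_apply]
    all_goals grind [Function.iterate_zero_apply]
  | succ m =>
    rw [pathElt_succ_mul_arr]
    split_ifs <;> simp only [map_zero, normalForm_pathElt, pathForm_apply_path,
      LinearMap.comp_apply, Finsupp.lapply_apply, LinearMap.zero_apply, Finsupp.zero_apply]
    all_goals grind

theorem normalForm_idem_mul_apply (a : Γ.BrauerAlgebra k) {x : Γ.Place} {n : ℕ}
    (h : n < Γ.cycleLength x.1) :
    normalForm Γ k (idem k x.source * a) (path x n h) = normalForm Γ k a (path x n h) := by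
  suffices Finsupp.lapply (path x n h) ∘ₗ normalForm Γ k ∘ₗ LinearMap.mulLeft k (idem k x.source) =
      Finsupp.lapply (path x n h) ∘ₗ normalForm Γ k from LinearMap.congr_fun this a
  refine linearMap_ext_pathElt fun y m => ?_
  simp only [LinearMap.comp_apply, Finsupp.lapply_apply, LinearMap.mulLeft_apply, idem_mul_pathElt]
  split_ifs with hs
  · rfl
  · rw [map_zero, Finsupp.zero_apply, normalForm_pathElt, pathForm_apply_path, if_neg]
    exact fun h => hs h.2.source_eq

theorem normalForm_mul_idem_apply (a : Γ.BrauerAlgebra k) (i : Γ.QVertex) {x : Γ.Place} {n : ℕ}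
    (h : n < Γ.cycleLength x.1) :
    normalForm Γ k (a * idem k i) (path x n h) =
      if (Place.next^[n] x).source = i then normalForm Γ k a (path x n h) else 0 := by
  suffices Finsupp.lapply (path x n h) ∘ₗ normalForm Γ k ∘ₗ LinearMap.mulRight k (idem k i) =
      if (Place.next^[n] x).source = i then
        Finsupp.lapply (path x n h) ∘ₗ normalForm Γ k else 0 by
    have := LinearMap.congr_fun this a
    split_ifs at this ⊢ <;> exact this
  refine linearMap_ext_pathElt fun z m => ?_
  simp only [LinearMap.comp_apply, Finsupp.lapply_apply, LinearMap.mulRight_apply, pathElt_mul_idem]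
  split_ifs <;> simp only [map_zero, normalForm_pathElt, pathForm_apply_path,
    LinearMap.comp_apply, Finsupp.lapply_apply, LinearMap.zero_apply, Finsupp.zero_apply]
  all_goals grind [Function.iterate_zero_apply]

end Coefficients

/-! ### The center -/

section Center

variable {k : Type w} [Field k]

theorem normalForm_path_next {z : Γ.BrauerAlgebra k} (hz : z ∈ Subalgebra.center k _) {x : Γ.Place}
    {n : ℕ} (h : n + 1 < Γ.cycleLength x.1) :
    normalForm Γ k z (path x.next n (Nat.lt_of_succ_lt h)) =
      if Γ.val x.1 ∣ n then normalForm Γ k z (path x n (Nat.lt_of_succ_lt h)) else 0 := by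
  rw [← normalForm_arr_mul_apply z h, Subalgebra.mem_center_iff.1 hz, normalForm_mul_arr_apply]
  exact if_congr (x.next_iterate_eq_self_iff n) rfl rfl

theorem normalForm_path_next_iterate {z : Γ.BrauerAlgebra k} (hz : z ∈ Subalgebra.center k _)
    {x y : Γ.Place} {n : ℕ} (hxy : x.1 = y.1) (h : n + 1 < Γ.cycleLength x.1)
    (hn : Γ.val x.1 ∣ n) :
    normalForm Γ k z (path x n (Nat.lt_of_succ_lt h)) =
      normalForm Γ k z (path y n (Nat.lt_of_succ_lt (hxy ▸ h))) := by
  obtain ⟨t, rfl⟩ := Place.exists_next_iterate_eq hxy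
  induction t with
  | zero => rfl
  | succ t ih =>
    have fst_eq := x.next_iterate_fst t
    simp only [Function.iterate_succ_apply']
    rw [normalForm_path_next hz (by rwa [fst_eq]), if_pos (by rwa [fst_eq]), ih fst_eq.symm]

theorem normalForm_path_eq_zero_of_not_dvd {z : Γ.BrauerAlgebra k}
    (hz : z ∈ Subalgebra.center k _) {x : Γ.Place} {n : ℕ} (h : n + 1 < Γ.cycleLength x.1)
    (hn : ¬Γ.val x.1 ∣ n) : normalForm Γ k z (path x n (Nat.lt_of_succ_lt h)) = 0 := by
  obtain ⟨y, rfl⟩ := Place.next_surjective x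
  exact (normalForm_path_next hz (x := y) h).trans (if_neg hn)

theorem normalForm_path_eq_zero_of_source_ne {z : Γ.BrauerAlgebra k}
    (hz : z ∈ Subalgebra.center k _) {x : Γ.Place} {n : ℕ} (h : n < Γ.cycleLength x.1)
    (hx : (Place.next^[n] x).source ≠ x.source) : normalForm Γ k z (path x n h) = 0 := by
  rw [← normalForm_idem_mul_apply, Subalgebra.mem_center_iff.1 hz, normalForm_mul_idem_apply,
    if_neg hx]

theorem IsConnected.normalForm_vertex_eq (hΓ : Γ.IsConnected) {z : Γ.BrauerAlgebra k}
    (hz : z ∈ Subalgebra.center k _) (i j : Γ.QVertex) :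
    normalForm Γ k z (vertex i) = normalForm Γ k z (vertex j) :=
  hΓ.eq_of_forall_next (g := fun i => normalForm Γ k z (vertex i)) (fun x =>
    (normalForm_path_next hz (one_lt_cycleLength x.1)).trans (if_pos (dvd_zero _))) i j

theorem mem_center_of_commute {z : Γ.BrauerAlgebra k} (idem_mul : ∀ i, idem k i * z = z * idem k i)
    (arr_mul : ∀ y, arr k y * z = z * arr k y) : z ∈ Subalgebra.center k _ := by
  suffices LinearMap.mulRight k z = LinearMap.mulLeft k z from
    Subalgebra.mem_center_iff.2 fun b => LinearMap.congr_fun this b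
  refine linearMap_ext_pathElt fun x n => ?_
  rw [LinearMap.mulRight_apply, LinearMap.mulLeft_apply]
  induction n generalizing x with
  | zero => rw [pathElt_zero, idem_mul]
  | succ n ih => rw [pathElt_succ, mul_assoc, ih, ← mul_assoc, arr_mul, mul_assoc]

theorem pathElt_mem_center {x : Γ.Place} {n : ℕ} (hn : Γ.cycleLength x.1 ≤ n + 1)
    (hx : (Place.next^[n] x).source = x.source) : pathElt k x n ∈ Subalgebra.center k _ := by
  obtain ⟨n, rfl⟩ := Nat.exists_eq_add_one.2
    (Nat.lt_of_lt_of_le (one_lt_cycleLength (Γ := Γ) x.1) hn |> Nat.lt_of_succ_lt_succ)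
  refine mem_center_of_commute (fun i => ?_) fun y => ?_
  · rw [idem_mul_pathElt, pathElt_mul_idem, hx]
  rw [arr_mul_pathElt, pathElt_succ_mul_arr]
  obtain hn | hn := hn.lt_or_eq
  · have arr_mul_eq_zero : SamePath y.next x (n + 1) → pathElt k y (n + 1 + 1) = 0 := fun h => by
      obtain rfl := (samePath_iff_of_pos n.succ_pos).1 h
      exact pathElt_eq_zero hn
    rw [pathElt_eq_zero hn, ite_self, ite_eq_right_iff.2 arr_mul_eq_zero]
  · have next_eq_iff : SamePath y.next x (n + 1) ↔ Place.next^[n + 1] x = y := by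
      rw [samePath_iff_of_pos n.succ_pos]
      constructor <;> rintro rfl
      · rw [← Function.iterate_succ_apply, Nat.succ_eq_add_one, ← hn]
        exact y.next_iterate_cycleLength
      · rw [← Function.iterate_succ_apply' Place.next, Nat.succ_eq_add_one, ← hn]
        exact x.next_iterate_cycleLength
    simp only [next_eq_iff]
    split_ifs with h
    · subst h
      rw [← hn, ← socleElt_source x, ← hx, socleElt_source, Place.next_iterate_fst]
    · rfl

variable (Γ k) in
/-- The sum of the `s`-th powers of all special cycles at the vertex `a`. -/
def cyclePowSum [Fintype V] (a : V) (s : ℕ) : Γ.BrauerAlgebra k :=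
  ∑ x : Γ.Place with x.1 = a, pathElt k x (s * Γ.val a)

theorem cyclePowSum_mem_center [Fintype V] (a : V) {s : ℕ} (hs : 0 < s) :
    cyclePowSum Γ k a s ∈ Subalgebra.center k _ := by
  obtain ⟨n, hn⟩ := Nat.exists_eq_add_one.2 (Nat.mul_pos hs (val_pos (Γ := Γ) a))
  have next_iterate_eq {x : Γ.Place} (hx : x.1 = a) : Place.next^[n + 1] x = x :=
    (x.next_iterate_eq_self_iff _).2 (by rw [hx, ← hn]; exact Nat.dvd_mul_left _ _)
  rw [cyclePowSum, hn]
  refine mem_center_of_commute (fun i => ?_) fun y => ?_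
  · rw [Finset.mul_sum, Finset.sum_mul]
    refine Finset.sum_congr rfl fun x hx => ?_
    rw [idem_mul_pathElt, pathElt_mul_idem, next_iterate_eq (Finset.mem_filter.1 hx).2]
  · have mul_arr {x : Γ.Place} (hx : x.1 = a) :
        pathElt k x (n + 1) * arr k y = if x = y then pathElt k x (n + 2) else 0 := by
      rw [pathElt_succ_mul_arr, next_iterate_eq hx]
    rw [Finset.mul_sum, Finset.sum_mul,
      Finset.sum_congr rfl fun x hx => mul_arr (Finset.mem_filter.1 hx).2]
    simp only [arr_mul_pathElt, samePath_iff_of_pos n.succ_pos, Finset.sum_ite_eq,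
      Finset.sum_ite_eq', Finset.mem_filter_univ, Place.next_fst]

theorem normalForm_one : normalForm Γ k 1 = ∑ i, Finsupp.single (vertex i) 1 := by
  rw [normalForm_apply, map_one, Module.End.one_apply]

theorem normalForm_one_apply_path (x : Γ.Place) (n : ℕ) (h : n < Γ.cycleLength x.1) :
    normalForm Γ k 1 (path x n h) = if n = 0 then 1 else 0 := by
  classical
  rw [normalForm_one, Finsupp.finsetSum_apply]
  cases n <;> simp [path, Finsupp.single_apply]

theorem normalForm_one_apply_socle (i : Γ.QVertex) : normalForm Γ k 1 (socle i) = 0 := by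
  rw [normalForm_one, Finsupp.finsetSum_apply]
  exact Finset.sum_eq_zero fun j _ => Finsupp.single_eq_of_ne nofun

theorem normalForm_socleElt (i : Γ.QVertex) :
    normalForm Γ k (socleElt k i) = Finsupp.single (socle i) 1 := by
  obtain ⟨x, rfl⟩ := Place.source_surjective i
  rw [socleElt_source, normalForm_pathElt, pathForm_cycleLength]

theorem normalForm_socleElt_apply_path (i : Γ.QVertex) (x : Γ.Place) (n : ℕ)
    (h : n < Γ.cycleLength x.1) : normalForm Γ k (socleElt k i) (path x n h) = 0 := by
  rw [normalForm_socleElt, Finsupp.single_eq_of_ne (path_ne_socle h _)]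

theorem normalForm_socleElt_apply_socle (i j : Γ.QVertex) :
    normalForm Γ k (socleElt k i) (socle j) = if j = i then 1 else 0 := by
  classical
  rw [normalForm_socleElt, Finsupp.single_apply]
  simp only [socle.injEq, eq_comm]

theorem normalForm_cyclePowSum_apply_path [Fintype V] (a : V) {s : ℕ} (hs : 0 < s) (x : Γ.Place)
    (n : ℕ) (h : n < Γ.cycleLength x.1) :
    normalForm Γ k (cyclePowSum Γ k a s) (path x n h) =
      if x.1 = a ∧ s * Γ.val a = n then 1 else 0 := by
  have pos : 0 < s * Γ.val a := Nat.mul_pos hs (val_pos a)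
  simp only [cyclePowSum, map_sum, normalForm_pathElt, Finsupp.finsetSum_apply,
    pathForm_apply_path]
  by_cases hn : s * Γ.val a = n
  · subst hn
    simp only [samePath_iff_of_pos pos, true_and, and_true, Finset.sum_ite_eq',
      Finset.mem_filter_univ]
  · simp only [hn, false_and, and_false, if_false, Finset.sum_const_zero]

theorem normalForm_cyclePowSum_apply_socle [Fintype V] (a : V) {s : ℕ} (hs : s < Γ.μ a)
    (i : Γ.QVertex) : normalForm Γ k (cyclePowSum Γ k a s) (socle i) = 0 := by
  rw [cyclePowSum, map_sum, Finsupp.finsetSum_apply]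
  refine Finset.sum_eq_zero fun x hx => ?_
  obtain rfl := (Finset.mem_filter.1 hx).2
  rw [normalForm_pathElt, pathForm_apply_socle, if_neg fun h => ?_]
  exact (Nat.mul_lt_mul_of_pos_right hs (val_pos x.1)).ne h.1

end Center

variable (Γ) in
/-- The loops of the Brauer quiver, given by the places at which they start. -/
abbrev Loop : Type u := {x : Γ.Place // x.next.source = x.source}

variable (Γ) in
/-- The exponents `s` such that the `s`-th power of a special cycle at the vertex `a` has at least
two arrows less than the power that lies in the socle, and is not trivial. -/
def exponents (a : V) : Finset ℕ := {s ∈ Finset.Ioo 0 (Γ.μ a) | s * Γ.val a + 1 < Γ.cycleLength a}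

variable (Γ) in
/-- The labels of a basis of the center of the Brauer configuration algebra: the unit, the socle
elements, the complements of the loops in the powers of special cycles, and the sums of powers of
special cycles. -/
abbrev CenterIndex : Type _ := Unit ⊕ Γ.QVertex ⊕ Γ.Loop ⊕ Σ a : V, Γ.exponents a

theorem mul_val_pos_of_mem_exponents {a : V} {s : ℕ} (hs : s ∈ Γ.exponents a) : 0 < s * Γ.val a :=
  Nat.mul_pos (Finset.mem_Ioo.1 (Finset.mem_filter.1 hs).1).1 (val_pos a)

variable (Γ) in
/-- The first place of the successor sequence of `a`. -/
def firstPlace (a : V) : Γ.Place := ⟨a, 0, (Γ.length_succSeq a).symm ▸ val_pos a⟩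

section Center

variable {k : Type w} [Field k]

variable (k) in
/-- The central element with a given label. -/
def centerElt [Fintype V] : Γ.CenterIndex → Γ.BrauerAlgebra k
  | .inl _ => 1
  | .inr (.inl i) => socleElt k i
  | .inr (.inr (.inl x)) => pathElt k x.1.next (Γ.cycleLength x.1.next.1 - 1)
  | .inr (.inr (.inr ⟨a, s⟩)) => cyclePowSum Γ k a s

/-- A normal word that occurs in the central element with a given label and in no other one. The
unit is represented by the trivial path at the place `x₀`. -/
def centerWord (x₀ : Γ.Place) : Γ.CenterIndex → Γ.NormalWord
  | .inl _ => path x₀ 0 (cycleLength_pos _)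
  | .inr (.inl i) => socle i
  | .inr (.inr (.inl x)) => path x.1.next (Γ.cycleLength x.1.next.1 - 1)
      (Nat.sub_lt (cycleLength_pos _) Nat.one_pos)
  | .inr (.inr (.inr ⟨a, s⟩)) => path (firstPlace Γ a) (s * Γ.val a)
      (Nat.lt_of_succ_lt (Finset.mem_filter.1 s.2).2)

theorem centerElt_mem_center [Fintype V] (c : Γ.CenterIndex) :
    centerElt k c ∈ Subalgebra.center k _ := by
  rcases c with _ | i | ⟨x, hx⟩ | ⟨a, s⟩
  · exact one_mem _
  · obtain ⟨x, rfl⟩ := Place.source_surjective i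
    rw [centerElt, socleElt_source]
    exact pathElt_mem_center (Nat.le_succ _) (by rw [x.next_iterate_cycleLength])
  · refine pathElt_mem_center (Nat.sub_add_cancel (cycleLength_pos _)).ge ?_
    exact (congrArg Place.source x.next_iterate_cycleLength_sub_one_next).trans hx.symm
  · exact cyclePowSum_mem_center a (Finset.mem_Ioo.1 (Finset.mem_filter.1 s.2).1).1

theorem normalForm_one_centerWord (x₀ : Γ.Place) (c : Γ.CenterIndex) :
    normalForm Γ k 1 (centerWord x₀ c) = if c = .inl () then 1 else 0 := by
  rcases c with _ | i | x | ⟨a, s, hs⟩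
  · rw [centerWord, normalForm_one_apply_path, if_pos rfl, if_pos rfl]
  · exact normalForm_one_apply_socle i
  · rw [centerWord, normalForm_one_apply_path, if_neg (cycleLength_sub_one_pos _).ne',
      if_neg nofun]
  · rw [centerWord, normalForm_one_apply_path,
      if_neg (mul_val_pos_of_mem_exponents hs).ne', if_neg nofun]

theorem normalForm_socleElt_centerWord (x₀ : Γ.Place) (i : Γ.QVertex) (c : Γ.CenterIndex) :
    normalForm Γ k (socleElt k i) (centerWord x₀ c) = if c = .inr (.inl i) then 1 else 0 := by
  rcases c with _ | j | x | s <;>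
    simp only [centerWord, normalForm_socleElt_apply_path, normalForm_socleElt_apply_socle,
      reduceCtorEq, Sum.inr.injEq, Sum.inl.injEq, if_false]

theorem normalForm_pathElt_centerWord (x₀ : Γ.Place) (x : Γ.Loop) (c : Γ.CenterIndex) :
    normalForm Γ k (pathElt k x.1.next (Γ.cycleLength x.1.next.1 - 1)) (centerWord x₀ c) =
      if c = .inr (.inr (.inl x)) then 1 else 0 := by
  rw [normalForm_pathElt]
  rcases c with _ | i | y | ⟨a, s, hs⟩ <;>
    simp only [centerWord, pathForm_apply_path, pathForm_apply_socle, reduceCtorEq,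
      Sum.inr.injEq, Sum.inl.injEq, if_false]
  · exact if_neg fun h => (cycleLength_sub_one_pos _).ne' h.1
  · exact if_neg fun h => (Nat.sub_lt (cycleLength_pos _) Nat.one_pos).ne h.1
  · refine if_congr ?_ rfl rfl
    rw [samePath_iff_of_pos (cycleLength_sub_one_pos _), Place.next_injective.eq_iff,
      ← Subtype.ext_iff]
    exact ⟨fun h => h.2.symm, by rintro rfl; exact ⟨rfl, rfl⟩⟩
  · refine if_neg fun h => (Finset.mem_filter.1 hs).2.ne ?_
    rw [← h.1, (samePath_iff_of_pos (mul_val_pos_of_mem_exponents hs)).1 h.2]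
    exact Nat.sub_add_cancel (cycleLength_pos _)

theorem normalForm_cyclePowSum_centerWord [Fintype V] (x₀ : Γ.Place) (a : V) (s : Γ.exponents a)
    (c : Γ.CenterIndex) :
    normalForm Γ k (cyclePowSum Γ k a s) (centerWord x₀ c) =
      if c = .inr (.inr (.inr ⟨a, s⟩)) then 1 else 0 := by
  obtain ⟨s, hs⟩ := s
  obtain ⟨mem, lt⟩ := Finset.mem_filter.1 hs
  obtain ⟨pos, lt_mul⟩ := Finset.mem_Ioo.1 mem
  rcases c with _ | i | y | ⟨b, t, ht⟩ <;>
    simp only [centerWord, normalForm_cyclePowSum_apply_path a pos,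
      normalForm_cyclePowSum_apply_socle a lt_mul, reduceCtorEq, Sum.inr.injEq, if_false]
  · exact if_neg fun h => (mul_val_pos_of_mem_exponents hs).ne' h.2
  · refine if_neg fun h => lt.ne ?_
    rw [h.2, ← h.1]
    exact Nat.sub_add_cancel (cycleLength_pos _)
  · refine if_congr ⟨?_, ?_⟩ rfl rfl
    · rintro ⟨rfl, h⟩
      obtain rfl := Nat.eq_of_mul_eq_mul_right (val_pos _) h
      rfl
    · intro h
      obtain ⟨rfl, h⟩ := Sigma.mk.inj h
      obtain rfl := congrArg Subtype.val (eq_of_heq h)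
      exact ⟨rfl, rfl⟩

theorem normalForm_centerElt_centerWord [Fintype V] (x₀ : Γ.Place) (c d : Γ.CenterIndex) :
    normalForm Γ k (centerElt k d) (centerWord x₀ c) = if c = d then 1 else 0 := by
  rcases d with _ | i | x | ⟨a, s⟩
  · exact normalForm_one_centerWord x₀ c
  · exact normalForm_socleElt_centerWord x₀ i c
  · exact normalForm_pathElt_centerWord x₀ x c
  · exact normalForm_cyclePowSum_centerWord x₀ a s c

theorem normalForm_path_eq_zero {z : Γ.BrauerAlgebra k} (hz : z ∈ Subalgebra.center k _)
    {x₀ : Γ.Place} (h : ∀ c, normalForm Γ k z (centerWord x₀ c) = 0) (x : Γ.Place) {n : ℕ}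
    (pos : 0 < n) (lt : n < Γ.cycleLength x.1) : normalForm Γ k z (path x n lt) = 0 := by
  obtain lt' | eq := (Nat.succ_le_iff.2 lt).lt_or_eq
  · by_cases hn : Γ.val x.1 ∣ n
    · refine (normalForm_path_next_iterate hz (x := x) (y := firstPlace Γ x.1) rfl lt' hn).trans ?_
      obtain ⟨s, rfl⟩ := exists_eq_mul_left_of_dvd hn
      have mem : s ∈ Γ.exponents x.1 := Finset.mem_filter.2
        ⟨Finset.mem_Ioo.2 ⟨Nat.pos_of_mul_pos_right pos, Nat.lt_of_mul_lt_mul_right lt⟩, lt'⟩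
      exact h (.inr (.inr (.inr ⟨x.1, s, mem⟩)))
    · exact normalForm_path_eq_zero_of_not_dvd hz lt' hn
  · obtain rfl : n = Γ.cycleLength x.1 - 1 := Nat.eq_sub_of_add_eq (b := 1) eq
    obtain ⟨y, rfl⟩ := Place.next_surjective x
    by_cases hy : y.next.source = y.source
    · exact h (.inr (.inr (.inl ⟨y, hy⟩)))
    · refine normalForm_path_eq_zero_of_source_ne hz lt fun h_eq => hy (h_eq.symm.trans ?_)
      exact congrArg Place.source y.next_iterate_cycleLength_sub_one_next

theorem IsConnected.eq_zero_of_normalForm_centerWord (hΓ : Γ.IsConnected) {z : Γ.BrauerAlgebra k}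
    (hz : z ∈ Subalgebra.center k _) {x₀ : Γ.Place}
    (h : ∀ c, normalForm Γ k z (centerWord x₀ c) = 0) : z = 0 := by
  refine normalForm_injective (Finsupp.ext fun b => ?_)
  rw [map_zero, Finsupp.zero_apply]
  cases b with
  | vertex i => exact (hΓ.normalForm_vertex_eq hz i x₀.source).trans (h (.inl ()))
  | run x n pos lt =>
    have := normalForm_path_eq_zero hz h x pos lt
    rwa [path, dif_pos pos] at this
  | socle i => exact h (.inr (.inl i))

theorem finrank_center [Fintype V] (hΓ : Γ.IsConnected) :
    Module.finrank k (Subalgebra.center k (Γ.BrauerAlgebra k)) =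
      1 + Fintype.card ι + Fintype.card Γ.Loop + ∑ a, (Γ.exponents a).card := by
  obtain ⟨i⟩ := hΓ.nonempty
  obtain ⟨x₀, -⟩ := Place.source_surjective (Γ := Γ) i
  have finrank_eq := finrank_eq_card_of_biorthogonal
    (Z := Subalgebra.toSubmodule (Subalgebra.center k (Γ.BrauerAlgebra k)))
    (centerElt k) (fun c => Finsupp.lapply (centerWord x₀ c) ∘ₗ normalForm Γ k)
    centerElt_mem_center (normalForm_centerElt_centerWord x₀)
    fun z hz h => hΓ.eq_zero_of_normalForm_centerWord hz h
  refine finrank_eq.trans ?_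
  simp only [CenterIndex, Fintype.card_sum, Fintype.card_unit, Fintype.card_sigma,
    Fintype.card_coe, ← add_assoc]
  rfl

end Center

end BrauerConfiguration

/-! ### Loops and sorted successor sequences -/

section CyclicSuccessor

variable {α : Type*} [LinearOrder α]

theorem card_ne_add_one_of_monotone {n : ℕ} {f : Fin (n + 1) → α} (hf : Monotone f)
    (ne : f 0 ≠ f (Fin.last n)) :
    (Finset.univ.filter fun t => f (t + 1) ≠ f t).card = (Finset.univ.image f).card := by
  have eq_add_one {t r : Fin (n + 1)} (htr : t < r) (h : f t = f r) : f (t + 1) = f t :=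
    le_antisymm (h ▸ hf (Fin.add_one_le_of_lt htr))
      (hf (Fin.lt_add_one_iff.2 (htr.trans_le (Fin.le_last r))).le)
  refine Finset.card_nbij f (fun t _ => Finset.mem_image_of_mem f (Finset.mem_univ t)) ?_ ?_
  · intro t ht r hr h
    rcases lt_trichotomy t r with htr | htr | htr
    · exact absurd (eq_add_one htr h) (Finset.mem_filter.1 ht).2
    · exact htr
    · exact absurd (eq_add_one htr h.symm) (Finset.mem_filter.1 hr).2
  · intro c hc
    obtain ⟨r, -, hr⟩ := Finset.mem_image.1 hc
    obtain ⟨t, ht, is_last⟩ := Finset.exists_max_image {t | f t = c} id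
      ⟨r, (Finset.mem_filter_univ r).2 hr⟩
    obtain rfl := (Finset.mem_filter_univ t).1 ht
    refine ⟨t, (Finset.mem_filter_univ t).2 fun h => ?_, rfl⟩
    have add_one_le : t + 1 ≤ t := is_last (t + 1) ((Finset.mem_filter_univ _).2 h)
    obtain rfl := Fin.last_le_iff.1 (not_lt.1 (mt Fin.lt_add_one_iff.2 add_one_le.not_gt))
    exact ne (by rw [← h, Fin.last_add_one])

theorem card_get_succ_eq_add_card_toFinset {s : List α} (hs : s.SortedLE)
    (nontrivial : s.toFinset.Nontrivial) :
    Fintype.card {t : Fin s.length //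
        s.get ⟨(t + 1) % s.length, Nat.mod_lt _ (Nat.zero_lt_of_lt t.isLt)⟩ = s.get t} +
      s.toFinset.card = s.length := by
  obtain _ | ⟨c, l⟩ := s
  · exact absurd nontrivial Finset.not_nontrivial_empty
  have succ_eq (t : Fin (l.length + 1)) :
      (⟨(t + 1) % (l.length + 1), Nat.mod_lt _ l.length.succ_pos⟩ : Fin (l.length + 1)) = t + 1 :=
    Fin.ext (by simp [Fin.val_add])
  have image_get : Finset.univ.image (c :: l).get = (c :: l).toFinset := by
    ext b
    simp only [Finset.mem_image, Finset.mem_univ, true_and, List.mem_toFinset, List.mem_iff_get]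
  have ne : (c :: l).get 0 ≠ (c :: l).get (Fin.last l.length) := by
    obtain ⟨a, ha, b, hb, hab⟩ := nontrivial
    contrapose! hab
    have eq_get_zero {b : α} (hb : b ∈ (c :: l).toFinset) : b = (c :: l).get 0 := by
      obtain ⟨t, rfl⟩ := List.get_of_mem (List.mem_toFinset.1 hb)
      exact le_antisymm (hab ▸ hs.monotone_get (Fin.le_last t)) (hs.monotone_get (Fin.zero_le t))
    rw [eq_get_zero ha, eq_get_zero hb]
  rw [← image_get, ← card_ne_add_one_of_monotone hs.monotone_get ne, Fintype.card_subtype]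
  simp only [List.length_cons, succ_eq]
  rw [Finset.card_filter_add_card_filter_not, Finset.card_univ, Fintype.card_fin]

end CyclicSuccessor

namespace BrauerConfiguration

section Count

variable {V : Type u} [DecidableEq V] {ι : Type v} [Fintype ι] [LinearOrder ι]
  {Γ : BrauerConfiguration V ι}

theorem mem_succSeq {a : V} {i : ι} : i ∈ Γ.succSeq a ↔ a ∈ Γ.polygon i := by
  rw [← List.count_pos_iff, Γ.count_succSeq, Multiset.count_pos]

theorem card_loops_at {a : V} (sorted : (Γ.succSeq a).SortedLE)
    (nontrivial : (Γ.succSeq a).toFinset.Nontrivial) :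
    (Fintype.card {t : Fin (Γ.succSeq a).length //
      Place.source (Γ := Γ) (Place.next ⟨a, t⟩) = Place.source (Γ := Γ) ⟨a, t⟩} : ℤ) =
      ∑ i with a ∈ Γ.polygon i, (((Γ.polygon i).count a : ℤ) - 1) := by
  have toFinset_eq : (Γ.succSeq a).toFinset = Finset.univ.filter fun i => a ∈ Γ.polygon i := by
    ext i
    rw [List.mem_toFinset, mem_succSeq, Finset.mem_filter_univ]
  have sum_count : Γ.val a = ∑ i with a ∈ Γ.polygon i, (Γ.polygon i).count a :=
    (Finset.sum_filter_of_ne fun i _ => Multiset.count_ne_zero.1).symm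
  have card_add := (card_get_succ_eq_add_card_toFinset sorted nontrivial).trans
    ((Γ.length_succSeq a).trans sum_count)
  rw [toFinset_eq] at card_add
  rw [Finset.sum_sub_distrib, ← Nat.cast_sum, ← card_add, Nat.cast_add, Finset.sum_const,
    nsmul_one, add_sub_cancel_right]
  rfl

theorem card_loop [Fintype V] (sorted : ∀ a, (Γ.succSeq a).SortedLE)
    (nontrivial : ∀ a, (Γ.succSeq a).toFinset.Nontrivial) :
    (Fintype.card Γ.Loop : ℤ) =
      ∑ i, ∑ a ∈ (Γ.polygon i).toFinset, (((Γ.polygon i).count a : ℤ) - 1) := by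
  let e : Γ.Loop ≃ Σ a : V, {t : Fin (Γ.succSeq a).length //
      Place.source (Γ := Γ) (Place.next ⟨a, t⟩) = Place.source (Γ := Γ) ⟨a, t⟩} :=
    { toFun x := ⟨x.1.1, x.1.2, x.2⟩
      invFun x := ⟨⟨x.1, x.2.1⟩, x.2.2⟩ }
  rw [Fintype.card_congr e, Fintype.card_sigma, Nat.cast_sum]
  simp only [card_loops_at (sorted _) (nontrivial _)]
  exact Finset.sum_comm' fun a i => by simp

end Count

end BrauerConfiguration

namespace Vigenere

variable {m n N : ℕ} [NeZero m] (y : Fin N → ZMod n) (hlen : ∀ i, 1 < (block m y i).length)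
  (hfreq : ∀ j, 1 < (List.ofFn y).count j)

theorem sortedLE_succSeq_configuration (j : ZMod n) :
    ((configuration m y hlen hfreq).succSeq j).SortedLE := by
  refine (List.pairwise_flatMap.2 ⟨fun i _ => List.pairwise_replicate.2 (.inr le_rfl), ?_⟩).sortedLE
  refine (List.pairwise_lt_finRange m).imp fun hab i hi i' hi' => ?_
  rw [List.eq_of_mem_replicate hi, List.eq_of_mem_replicate hi']
  exact hab.le

theorem exponents_configuration (j : ZMod n) :
    (configuration m y hlen hfreq).exponents j = ∅ := rfl

theorem isConnected_configuration_of_forall_mem (mem : ∀ i j, j ∈ block m y i) :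
    (configuration m y hlen hfreq).IsConnected where
  preconnected i i' := by
    obtain rfl | h := eq_or_ne i i'
    · rfl
    · exact ((SimpleGraph.fromRel_adj ..).2 ⟨h, .inl ⟨0, mem i 0, mem i' 0⟩⟩).reachable
  nonempty := ⟨0⟩

theorem finrank_center_configuration (k : Type*) [Field k] [NeZero n]
    (connected : (configuration m y hlen hfreq).IsConnected)
    (shared : ∀ j, ∃ i i', i ≠ i' ∧ j ∈ block m y i ∧ j ∈ block m y i') :
    (Module.finrank k (Subalgebra.center k
        ((configuration m y hlen hfreq).BrauerAlgebra k)) : ℤ) =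
      1 + m + ∑ i : Fin m, ∑ j ∈ (block m y i).toFinset, (((block m y i).count j : ℤ) - 1) := by
  have nontrivial (j : ZMod n) :
      ((configuration m y hlen hfreq).succSeq j).toFinset.Nontrivial := by
    obtain ⟨i, i', hne, hi, hi'⟩ := shared j
    exact ⟨i, List.mem_toFinset.2 (BrauerConfiguration.mem_succSeq.2 hi),
      i', List.mem_toFinset.2 (BrauerConfiguration.mem_succSeq.2 hi'), hne⟩
  rw [BrauerConfiguration.finrank_center connected]
  simp only [exponents_configuration, Finset.card_empty, Finset.sum_const_zero, add_zero,
    Fintype.card_fin, Nat.cast_add, Nat.cast_one]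
  rw [BrauerConfiguration.card_loop (sortedLE_succSeq_configuration y hlen hfreq) nontrivial]
  simp only [configuration, Multiset.coe_count]
  rfl

end Vigenere

end

theorem theorem3p3 (k : Type*) [Field k] (m n N : ℕ) [NeZero m] [NeZero n]
    (hm : 1 < m) (hn : 1 < n)
    (K : Fin m → ZMod n) (x y : Fin N → ZMod n) (hy : y = Vigenere.encrypt K x)
    (hlen : ∀ i, 1 < (Vigenere.block m y i).length)
    (hfreq : ∀ j, 1 < (List.ofFn y).count j) :
    ((∀ i j, j ∈ Vigenere.block m y i) →
      (Module.finrank k (Subalgebra.center k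
          ((Vigenere.configuration m y hlen hfreq).BrauerAlgebra k)) : ℤ) =
        1 + m + ∑ i : Fin m, ∑ j : ZMod n, (((Vigenere.block m y i).count j : ℤ) - 1)) ∧
    ((Vigenere.configuration m y hlen hfreq).IsConnected →
      (∀ j, ∃ i i', i ≠ i' ∧ j ∈ Vigenere.block m y i ∧ j ∈ Vigenere.block m y i') →
      (Module.finrank k (Subalgebra.center k
          ((Vigenere.configuration m y hlen hfreq).BrauerAlgebra k)) : ℤ) =
        1 + m + ∑ i : Fin m, ∑ j ∈ (Vigenere.block m y i).toFinset,
          (((Vigenere.block m y i).count j : ℤ) - 1)) := by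
  refine ⟨fun mem => ?_, Vigenere.finrank_center_configuration y hlen hfreq k⟩
  have connected := Vigenere.isConnected_configuration_of_forall_mem y hlen hfreq mem
  have shared (j : ZMod n) :
      ∃ i i', i ≠ i' ∧ j ∈ Vigenere.block m y i ∧ j ∈ Vigenere.block m y i' :=
    ⟨⟨0, Nat.zero_lt_of_lt hm⟩, ⟨1, hm⟩, by simp, mem _ j, mem _ j⟩
  have toFinset_eq_univ (i : Fin m) : (Vigenere.block m y i).toFinset = Finset.univ :=
    Finset.eq_univ_of_forall fun j => List.mem_toFinset.2 (mem i j)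
  rw [Vigenere.finrank_center_configuration y hlen hfreq k connected shared]
  simp only [toFinset_eq_univ]
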